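/- Let $\mathcal D$ be a triangulated category and let $\mathcal A$ be the heart of a bounded t-structure on $\mathcal D$. A heart is called \emph{algebraic} if all its objects have finite length and it has, up to isomorphism, only finitely many simple objects. For an object $E$ of $\mathcal A$, let $\langle E\rangle$ be the extension-closed full subcategory of $\mathcal A$ generated by $E$ (it contains $0$). For full subcategories $\mathcal C_1,\mathcal C_2\subset\mathcal A$, let $\mathcal C_1\star\mathcal C_2$ be the full subcategory of all $E$ for which there is a short exact sequence $0\to C_1\to E\to C_2\to 0$ with $C_i\in\mathcal C_i$. A \emph{torsion pair} in $\mathcal A$ is a pair $(\mathcal T,\mathcal F)$ of isomorphism-closed full subcategories with $\mathrm{Hom}(T,F)=0$ for all $T\in\mathcal T$, $F\in\mathcal F$, and $\mathcal T\star\mathcal F=\mathcal A$; then $\mathcal T$ is called a \emph{torsion class}. The \emph{simple tilt} of an algebraic heart $\mathcal A'$ at a simple object $S\in\mathcal A'$ is the heart $\mathcal A'_S$ of all $E\in\mathcal D$ that fit into a distinguished triangle $F\to E\to T[-1]\to F[1]$ with $T\in\langle S\rangle$ and with $F\in\mathcal A'$ such that $\mathrm{Hom}(S,F)=0$. Suppose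 that $\mathcal A$ is algebraic with $n$ simple objects up to isomorphism and that $\mathcal A$ can be tilted indefinitely, i.e. every heart obtained from $\mathcal A$ by a finite sequence of simple tilts is again algebraic with $n$ simple objects. Suppose also that the set of classes in the Grothendieck group $K(\mathcal A)$ of the objects $E$ of $\mathcal A$ whose endomorphism ring $\mathrm{Hom}_{\mathcal A}(E,E)$ is a skew field is finite. Then for every torsion class $\mathcal T$ in $\mathcal A$ there are an integer $m\ge 0$ and indecomposable objects $E_1,\dots,E_m$ of $\mathcal A$ such that $$\mathcal T=((\langle E_1\rangle\star\langle E_2\rangle)\star\cdots)\star\langle E_m\rangle$$ (for $m=0$ the right-hand side is the subcategory of zero objects) and such that $E_1,\dots,E_m$ are, in this order, the objects at which one tilts in a green sequence of $\mathcal A$: with $\mathcal A_0=\mathcal A$ and $\mathcal A_i=(\mathcal A_{i-1})_{E_i}$, each $E_i$ lies in $\mathcal A$ and is a simple object of $\mathcal A_{i-1}$. -/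

import Mathlib

open CategoryTheory CategoryTheory.Limits CategoryTheory.Triangulated

universe v u

namespace HeartTilting

section Abelian

/-! Notions for an abelian category. They only use zero morphisms, so that they can be applied
directly to the full subcategory underlying the heart of a t-structure. -/

variable {C : Type u} [Category.{v} C] [HasZeroMorphisms C]

/-- The Gabriel product `P ⋆ Q`: all objects `E` which fit into a short exact sequence
`0 ⟶ X ⟶ E ⟶ Y ⟶ 0` with `X` in `P` and `Y` in `Q`. -/
def gabrielProduct (P Q : ObjectProperty C) : ObjectProperty C := fun E =>
  ∃ (X Y : C) (i : X ⟶ E) (p : E ⟶ Y) (w : i ≫ p = 0),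
    (ShortComplex.mk i p w).ShortExact ∧ P X ∧ Q Y

/-- The extension-closed full subcategory generated by `P`. It contains the zero objects, and it is
closed under isomorphisms, as these are extensions by zero objects. -/
inductive extensionClosure (P : ObjectProperty C) : ObjectProperty C
  | zero (X : C) (hX : IsZero X) : extensionClosure P X
  | of (X : C) (hX : P X) : extensionClosure P X
  | ext {X E Y : C} (i : X ⟶ E) (p : E ⟶ Y) (w : i ≫ p = 0)
      (hS : (ShortComplex.mk i p w).ShortExact)
      (hX : extensionClosure P X) (hY : extensionClosure P Y) : extensionClosure P E

/-- The extension-closed full subcategory `⟨E⟩` generated by one object. -/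
def generatedBy (E : C) : ObjectProperty C :=
  extensionClosure (ObjectProperty.singleton E)

/-- The left-bracketed product `((⟨E₁⟩ ⋆ ⟨E₂⟩) ⋆ ⋯) ⋆ ⟨Eₘ⟩`. For `m = 0` it is the subcategory of
zero objects. -/
def iteratedProduct : List C → ObjectProperty C
  | [] => fun X => IsZero X
  | E :: L => L.foldl (fun P E' => gabrielProduct P (generatedBy E')) (generatedBy E)

/-- A torsion pair `(T, F)`, where `T` and `F` are (strictly) full subcategories. -/
structure IsTorsionPair (T F : ObjectProperty C) : Prop where
  isClosedUnderIsomorphisms_left : T.IsClosedUnderIsomorphisms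
  isClosedUnderIsomorphisms_right : F.IsClosedUnderIsomorphisms
  hom_eq_zero : ∀ ⦃X Y : C⦄, T X → F Y → ∀ f : X ⟶ Y, f = 0
  gabrielProduct : ∀ E : C, gabrielProduct T F E

/-- `T` is the torsion class of a torsion pair. -/
def IsTorsionClass (T : ObjectProperty C) : Prop :=
  ∃ F : ObjectProperty C, IsTorsionPair T F

/-- The endomorphism ring of `E` is a skew field. -/
def IsEndoTrivial (E : C) : Prop :=
  𝟙 E ≠ 0 ∧ ∀ f : E ⟶ E, f ≠ 0 → IsIso f

/-- `E` is nonzero and is not a direct sum of two nonzero objects. -/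
def IsIndecomposable (E : C) : Prop :=
  ¬ IsZero E ∧ ∀ (X Y : C) (b : BinaryBicone X Y), Nonempty b.IsBilimit →
    Nonempty (E ≅ b.pt) → IsZero X ∨ IsZero Y

variable (C) in
/-- Every object has finite length: there are no infinite strictly ascending or strictly descending
chains of subobjects. -/
def HasFiniteLength : Prop :=
  ∀ X : C, IsNoetherianObject X ∧ IsArtinianObject X

variable (C) in
/-- The set of isomorphism classes of simple objects. -/
def simpleClasses : Set (Quotient (isIsomorphicSetoid C)) :=
  {q | ∃ S : C, Simple S ∧ Quotient.mk (isIsomorphicSetoid C) S = q}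

variable (C) in
/-- Finite length and, up to isomorphism, finitely many simple objects. -/
def IsAlgebraic : Prop :=
  HasFiniteLength C ∧ (simpleClasses C).Finite

variable (C) in
/-- The relations `[E] - [X] - [Y]`, one for every short exact sequence
`0 ⟶ X ⟶ E ⟶ Y ⟶ 0`. -/
def grothendieckRelations : Set (FreeAbelianGroup C) :=
  {r | ∃ S : ShortComplex C, S.ShortExact ∧
    r = FreeAbelianGroup.of S.X₂ - FreeAbelianGroup.of S.X₁ - FreeAbelianGroup.of S.X₃}

variable (C) in
/-- The Grothendieck group. -/
abbrev GrothendieckGroup : Type u :=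
  FreeAbelianGroup C ⧸ AddSubgroup.closure (grothendieckRelations C)

/-- The class `[E]` in the Grothendieck group. -/
def grothendieckClass (E : C) : GrothendieckGroup C :=
  QuotientAddGroup.mk (FreeAbelianGroup.of E)

end Abelian

section Tilting

/-! A heart of a bounded t-structure on `D` is given by its property of objects of `D`. -/

variable {D : Type u} [Category.{v} D] [Preadditive D] [HasZeroObject D] [HasShift D ℤ]
  [∀ n : ℤ, (shiftFunctor D n).Additive] [Pretriangulated D]

/-- The left tilt of the heart `A` with respect to a torsion pair `(T, F)` in `A`: all `E` in `D`
for which there is a distinguished triangle `X ⟶ E ⟶ Y[-1] ⟶ X[1]` with `X` in `F` and `Y` in `T`,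
that is, `H⁰(E) = X` is in `F`, `H¹(E) = Y` is in `T` and all other cohomology objects of `E` with
respect to the t-structure with heart `A` are zero. (`P.shift 1` is the property that `E[1]`
satisfies `P`, hence it is `P[-1]`.) -/
def leftTilt (A : ObjectProperty D) (T F : ObjectProperty A.FullSubcategory) : ObjectProperty D :=
  ObjectProperty.extensionProduct (F.map A.ι) ((T.map A.ι).shift (1 : ℤ))

/-- The simple (left) tilt of the heart `A` at `S`: the left tilt with respect to the torsion pair
`(⟨S⟩, {E | Hom(S, E) = 0})`. -/
def simpleTilt (A : ObjectProperty D) (S : A.FullSubcategory) : ObjectProperty D :=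
  leftTilt A (generatedBy S) (fun E => ∀ f : S ⟶ E, f = 0)

/-- `IsIteratedSimpleTilt A A'`: the heart `A'` is obtained from `A` by a finite sequence of simple
tilts. -/
inductive IsIteratedSimpleTilt (A : ObjectProperty D) : ObjectProperty D → Prop
  | refl : IsIteratedSimpleTilt A A
  | tilt (A' : ObjectProperty D) (S : A'.FullSubcategory) (hA' : IsIteratedSimpleTilt A A')
      (hS : Simple S) : IsIteratedSimpleTilt A (simpleTilt A' S)

/-- Every heart obtained from `A` by a finite sequence of simple tilts is again algebraic, with the
same number of simple objects as `A`. -/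
def CanBeTiltedIndefinitely (A : ObjectProperty D) : Prop :=
  ∀ A' : ObjectProperty D, IsIteratedSimpleTilt A A' →
    IsAlgebraic A'.FullSubcategory ∧
      (simpleClasses A'.FullSubcategory).encard = (simpleClasses A.FullSubcategory).encard

/-- `IsGreenFrom A A' [S₁, …, Sₘ]`: starting from the heart `A'`, one can successively perform simple
tilts at `S₁, …, Sₘ` (each `Sᵢ` being a simple object of the heart reached before it), and all `Sᵢ`
lie in `A`. -/
def IsGreenFrom (A : ObjectProperty D) : ObjectProperty D → List D → Prop
  | _, [] => True
  | A', S :: L => A S ∧ ∃ hS : A' S,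
      Simple (ObjectProperty.FullSubcategory.mk S hS : A'.FullSubcategory) ∧
        IsGreenFrom A (simpleTilt A' (ObjectProperty.FullSubcategory.mk S hS)) L

/-- `[S₁, …, Sₘ]` is the list of the objects at which one tilts, in this order, in a green sequence
of the heart `A`. -/
def IsGreenSequence (A : ObjectProperty D) (L : List D) : Prop :=
  IsGreenFrom A A L

end Tilting

end HeartTilting

open HeartTilting

/-!
The proof tilts greedily. Let `T` be a torsion class in the heart `A`. If `T` is nonzero, it
contains a simple object `S` of `A`, namely a simple quotient of any nonzero object of `T`. Then
`T = ⟨S⟩ ⋆ T'` with `T' = {X ∈ T | Hom(S, X) = 0}`, and `T'` is a torsion class in the simple tilt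
of `A` at `S` (`IsTorsionPairIn.left_eq_extensionProduct`,
`IsTorsionPairIn.tilt_isTorsionPairIn`). The same step applies to `T'` in the tilted heart, and so
on (`exists_greenFrom`). All simple objects used lie in `T`, hence in `A`, so the tilts form a
green sequence, and once the remaining torsion class is zero, `T` is the product of the `⟨Eᵢ⟩`. As
a simple object of some heart, every `Eᵢ` has a skew field as its endomorphism ring, so it is
indecomposable.

The recursion stops because the classes `[Eᵢ]` in `K(A)` are distinct and lie in a finite set. Let
`B` be the heart reached after tilting at `Eᵢ`. All objects of `A` have cohomology with respect to
`B` only in degrees `-1` and `0`, and `X ↦ length H⁰(X) - length H⁻¹(X)` is additive, so it is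
defined on `K(A)` (`exists_eulerHom`). It is negative on `Eᵢ`, as `Eᵢ[-1]` is a nonzero object of
`B`, and nonnegative on `A ∩ B`, which contains all later `Eⱼ` (`grothendieckClass_ne`).

Everything is done inside the triangulated category. Short exact sequences in a heart are the
distinguished triangles with vertices in the heart (`shortExact_of_distTriang`,
`exists_distTriang_of_shortExact`), Gabriel products become extension products
(`gabrielProduct_inverseImage`), and the associativity of the extension product replaces most
diagram chases. Two results that this needs are proved on the way: the tilt of a t-structure at a
torsion pair is a t-structure (`IsTorsionPairIn.tilt`, `IsTorsionPairIn.heart_tilt`), and length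
in the heart is well defined and additive (`lengthProp_unique`, `extensionProduct_lengthProp`).
-/

namespace HeartTilting

open Pretriangulated ObjectProperty

/-! ### Distinguished triangles -/

section Triangles

variable {D : Type u} [Category.{v} D] [Preadditive D] [HasZeroObject D] [HasShift D ℤ]
  [∀ n : ℤ, (shiftFunctor D n).Additive] [Pretriangulated D]

lemma distTriang_of_iso {X Y Z X' Y' Z' : D} {f : X ⟶ Y} {g : Y ⟶ Z} {h : Z ⟶ X⟦(1 : ℤ)⟧}
    (hT : Triangle.mk f g h ∈ distTriang D) (e₁ : X' ≅ X) (e₂ : Y' ≅ Y) (e₃ : Z' ≅ Z)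
    {f' : X' ⟶ Y'} {g' : Y' ⟶ Z'} {h' : Z' ⟶ X'⟦(1 : ℤ)⟧} (hf : f' ≫ e₂.hom = e₁.hom ≫ f)
    (hg : g' ≫ e₃.hom = e₂.hom ≫ g) (hh : h' ≫ e₁.hom⟦1⟧' = e₃.hom ≫ h) :
    Triangle.mk f' g' h' ∈ distTriang D :=
  isomorphic_distinguished _ hT _ (Triangle.isoMk _ _ e₁ e₂ e₃ hf hg hh)

lemma exists_lift_of_comp_eq_zero {W X Y Z : D} {f : X ⟶ Y} {g : Y ⟶ Z} {h : Z ⟶ X⟦(1 : ℤ)⟧}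
    (hT : Triangle.mk f g h ∈ distTriang D) (k : W ⟶ Y) (hk : k ≫ g = 0) :
    ∃ l : W ⟶ X, l ≫ f = k := by
  obtain ⟨l, hl⟩ := Triangle.coyoneda_exact₂ _ hT k hk
  exact ⟨l, hl.symm⟩

lemma exists_desc_of_comp_eq_zero {W X Y Z : D} {f : X ⟶ Y} {g : Y ⟶ Z} {h : Z ⟶ X⟦(1 : ℤ)⟧}
    (hT : Triangle.mk f g h ∈ distTriang D) (k : Y ⟶ W) (hk : f ≫ k = 0) :
    ∃ l : Z ⟶ W, g ≫ l = k := by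
  obtain ⟨l, hl⟩ := Triangle.yoneda_exact₂ _ hT k hk
  exact ⟨l, hl.symm⟩

lemma exists_desc_shift_of_comp_eq_zero {W X Y Z : D} {f : X ⟶ Y} {g : Y ⟶ Z}
    {h : Z ⟶ X⟦(1 : ℤ)⟧} (hT : Triangle.mk f g h ∈ distTriang D) (k : Z ⟶ W)
    (hk : g ≫ k = 0) : ∃ l : X⟦(1 : ℤ)⟧ ⟶ W, h ≫ l = k := by
  obtain ⟨l, hl⟩ := Triangle.yoneda_exact₃ _ hT k hk
  exact ⟨l, hl.symm⟩

lemma exists_lift_shift_of_comp_eq_zero {W X Y Z : D} {f : X ⟶ Y} {g : Y ⟶ Z}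
    {h : Z ⟶ X⟦(1 : ℤ)⟧} (hT : Triangle.mk f g h ∈ distTriang D) (k : W ⟶ X)
    (hk : k ≫ f = 0) : ∃ (l : W ⟶ Z⟦(-1 : ℤ)⟧) (m : Z⟦(-1 : ℤ)⟧ ⟶ X), l ≫ m = k := by
  obtain ⟨l, hl⟩ := Triangle.coyoneda_exact₂ _ (inv_rot_of_distTriang _ hT) k hk
  exact ⟨l, _, hl.symm⟩

end Triangles

/-! ### The heart of a t-structure as an abelian category -/

section Heart

variable {D : Type u} [Category.{v} D] [Preadditive D] [HasZeroObject D] [HasShift D ℤ]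
  [∀ n : ℤ, (shiftFunctor D n).Additive] [Pretriangulated D]

variable (t : TStructure D)

instance isTriangulatedClosed₂_le (n : ℤ) : (t.le n).IsTriangulatedClosed₂ :=
  .mk' fun T hT h₁ h₃ => (t.isLE₂ T hT n ⟨h₁⟩ ⟨h₃⟩).le

instance isTriangulatedClosed₂_ge (n : ℤ) : (t.ge n).IsTriangulatedClosed₂ :=
  .mk' fun T hT h₁ h₃ => (t.isGE₂ T hT n ⟨h₁⟩ ⟨h₃⟩).ge

instance isTriangulatedClosed₂_heart : t.heart.IsTriangulatedClosed₂ :=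
  .mk' fun T hT h₁ h₃ =>
    ⟨(t.isLE₂ T hT 0 ⟨h₁.1⟩ ⟨h₃.1⟩).le, (t.isGE₂ T hT 0 ⟨h₁.2⟩ ⟨h₃.2⟩).ge⟩

lemma heart_of_isZero {X : D} (hX : IsZero X) : t.heart X :=
  ⟨(t.isLE_of_isZero hX 0).le, (t.isGE_of_isZero hX 0).ge⟩

instance containsZero_heart : t.heart.ContainsZero :=
  ⟨_, isZero_zero D, heart_of_isZero t (isZero_zero D)⟩

variable {t}

lemma hom_eq_zero_of_le_of_ge {X Y : D} {m n : ℤ} (hX : t.le m X) (hY : t.ge n Y) (h : m < n)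
    (f : X ⟶ Y) : f = 0 :=
  t.zero_of_isLE_of_isGE f m n h ⟨hX⟩ ⟨hY⟩

lemma hom_shift_eq_zero_of_neg {X Y : D} (hX : t.heart X) (hY : t.heart Y) {n : ℤ} (hn : n < 0)
    (f : X ⟶ Y⟦n⟧) : f = 0 :=
  hom_eq_zero_of_le_of_ge hX.1 (t.ge_shift 0 n (-n) (by lia) Y hY.2) (by lia) f

lemma shift_one_le {X : D} (hX : t.heart X) : t.le (-1) (X⟦(1 : ℤ)⟧) :=
  t.le_shift 0 1 (-1) (by lia) X hX.1

lemma heart_shift_one_of {X : D} (h₁ : t.le 1 X) (h₂ : t.ge 1 X) : t.heart (X⟦(1 : ℤ)⟧) :=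
  ⟨t.le_shift 1 1 0 (by lia) X h₁, t.ge_shift 1 1 0 (by lia) X h₂⟩

lemma heart_shift_neg_one_of {X : D} (h₁ : t.le (-1) X) (h₂ : t.ge (-1) X) :
    t.heart (X⟦(-1 : ℤ)⟧) :=
  ⟨t.le_shift (-1) (-1) 0 (by lia) X h₁, t.ge_shift (-1) (-1) 0 (by lia) X h₂⟩

lemma le_of_distTriang₃ {X Y Z : D} {f : X ⟶ Y} {g : Y ⟶ Z} {h : Z ⟶ X⟦(1 : ℤ)⟧}
    (hT : Triangle.mk f g h ∈ distTriang D) {n : ℤ} (hX : t.le (n + 1) X) (hY : t.le n Y) :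
    t.le n Z :=
  ext_of_isTriangulatedClosed₂ (t.le n) _ (rot_of_distTriang _ hT) hY
    (t.le_shift (n + 1) 1 n (by lia) X hX)

lemma ge_of_distTriang₃ {X Y Z : D} {f : X ⟶ Y} {g : Y ⟶ Z} {h : Z ⟶ X⟦(1 : ℤ)⟧}
    (hT : Triangle.mk f g h ∈ distTriang D) {n : ℤ} (hX : t.ge (n + 1) X) (hY : t.ge n Y) :
    t.ge n Z :=
  ext_of_isTriangulatedClosed₂ (t.ge n) _ (rot_of_distTriang _ hT) hY
    (t.ge_shift (n + 1) 1 n (by lia) X hX)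

lemma ge_of_distTriang₁ {X Y Z : D} {f : X ⟶ Y} {g : Y ⟶ Z} {h : Z ⟶ X⟦(1 : ℤ)⟧}
    (hT : Triangle.mk f g h ∈ distTriang D) {n : ℤ} (hY : t.ge n Y) (hZ : t.ge (n - 1) Z) :
    t.ge n X :=
  ext_of_isTriangulatedClosed₂ (t.ge n) _ (inv_rot_of_distTriang _ hT)
    (t.ge_shift (n - 1) (-1) n (by lia) Z hZ) hY

/-- An object with cohomology only in degrees `-1` and `0` is an extension of its `H⁰` by its
shifted `H⁻¹`. -/
lemma exists_distTriang_of_le_of_ge {E : D} (h₁ : t.le 0 E) (h₂ : t.ge (-1) E) :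
    ∃ (A C : D) (f : A⟦(1 : ℤ)⟧ ⟶ E) (g : E ⟶ C) (h : C ⟶ A⟦(1 : ℤ)⟧⟦(1 : ℤ)⟧),
      Triangle.mk f g h ∈ distTriang D ∧ t.heart A ∧ t.heart C := by
  obtain ⟨X, C, hX, hC, f, g, h, hT⟩ := t.exists_triangle E (-1) 0 (by lia)
  have hC' : t.heart C :=
    ⟨le_of_distTriang₃ hT (t.le_monotone (by lia) X hX) h₁, hC⟩
  have hX' : t.ge (-1) X :=
    ge_of_distTriang₁ hT h₂ (t.ge_antitone (by lia) C hC)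
  let e : X⟦(-1 : ℤ)⟧⟦(1 : ℤ)⟧ ≅ X := (shiftEquiv D (1 : ℤ)).counitIso.app X
  refine ⟨X⟦(-1 : ℤ)⟧, C, e.hom ≫ f, g, h ≫ e.inv⟦1⟧', ?_, heart_shift_neg_one_of hX hX', hC'⟩
  exact distTriang_of_iso hT e (Iso.refl _) (Iso.refl _) (by simp) (by simp)
    (by simp [← Functor.map_comp])

lemma hom_ι_eq_zero ⦃X Y : t.heart.FullSubcategory⦄ ⦃n : ℤ⦄
    (f : t.heart.ι.obj X ⟶ (t.heart.ι.obj Y)⟦n⟧) (hn : n < 0) : f = 0 :=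
  hom_shift_eq_zero_of_neg X.property Y.property hn f

instance isClosedUnderFiniteProducts_heart : t.heart.IsClosedUnderFiniteProducts := by
  have : t.heart.IsClosedUnderBinaryProducts :=
    { limitsOfShape_le := by
        rintro X ⟨p⟩
        refine t.heart.prop_of_iso ?_ (t.heart.ext_of_isTriangulatedClosed₂ _
          (binaryProductTriangle_distinguished _ _)
          (p.prop_diag_obj (.mk .left)) (p.prop_diag_obj (.mk .right)))
        exact IsLimit.conePointUniqueUpToIso (prodIsProd _ _)
          ((IsLimit.postcomposeHomEquiv (diagramIsoPair p.diag) _).2 p.isLimit) }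
  exact .mk'

variable (t) in
lemma admissibleMorphism_heart : AbelianSubcategory.admissibleMorphism t.heart.ι = ⊤ := by
  rw [eq_top_iff]
  intro X₁ X₂ f _ X₃ f₂ f₃ hT
  obtain ⟨A, C, α, β, γ, hT', hA, hC⟩ := exists_distTriang_of_le_of_ge (t := t) (E := X₃)
    (le_of_distTriang₃ hT (t.le_monotone (by lia) _ X₁.property.1) X₂.property.1)
    (ge_of_distTriang₃ hT X₁.property.2 (t.ge_antitone (by lia) _ X₂.property.2))
  exact ⟨⟨A, hA⟩, ⟨C, hC⟩, α, β, γ, hT'⟩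

instance hasKernels_heart : HasKernels t.heart.FullSubcategory where
  has_limit f := AbelianSubcategory.hasKernel_of_admissibleMorphism hom_ι_eq_zero f
    (by simp [admissibleMorphism_heart t])

instance hasCokernels_heart : HasCokernels t.heart.FullSubcategory where
  has_colimit f := AbelianSubcategory.hasCokernel_of_admissibleMorphism hom_ι_eq_zero f
    (by simp [admissibleMorphism_heart t])

end Heart

section HeartAbelian

variable {D : Type u} [Category.{v} D] [Preadditive D] [HasZeroObject D] [HasShift D ℤ]
  [∀ n : ℤ, (shiftFunctor D n).Additive] [Pretriangulated D] [IsTriangulated D]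

variable {t : TStructure D}

variable (t) in
/-- The heart of a t-structure is abelian. -/
noncomputable abbrev abelianHeart : Abelian t.heart.FullSubcategory :=
  AbelianSubcategory.abelian t.heart.ι hom_ι_eq_zero (admissibleMorphism_heart t)

instance categoryWithHomology_heart : CategoryWithHomology t.heart.FullSubcategory :=
  @categoryWithHomology_of_abelian _ _ (abelianHeart t)

instance isNormalMonoCategory_heart : IsNormalMonoCategory t.heart.FullSubcategory :=
  @Abelian.toIsNormalMonoCategory _ _ (abelianHeart t)

/-- A distinguished triangle with vertices in the heart is a short exact sequence. -/
lemma shortExact_of_distTriang {X Y Z : t.heart.FullSubcategory} (f : X ⟶ Y) (g : Y ⟶ Z)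
    {δ : Z.obj ⟶ X.obj⟦(1 : ℤ)⟧} (hT : Triangle.mk f.hom g.hom δ ∈ distTriang D)
    (w : f ≫ g = 0) : (ShortComplex.mk f g w).ShortExact := by
  have hk := AbelianSubcategory.isLimitKernelForkOfDistTriang hom_ι_eq_zero f g δ hT
  have hc := AbelianSubcategory.isColimitCokernelCoforkOfDistTriang hom_ι_eq_zero f g δ hT
  exact
    { exact := ShortComplex.exact_of_f_is_kernel _ hk
      mono_f := mono_of_isLimit_fork hk
      epi_g := epi_of_isColimit_cofork hc }

/-- A short exact sequence in the heart can be completed to a distinguished triangle. -/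
lemma exists_distTriang_of_shortExact {S : ShortComplex t.heart.FullSubcategory}
    (hS : S.ShortExact) :
    ∃ δ : S.X₃.obj ⟶ S.X₁.obj⟦(1 : ℤ)⟧, Triangle.mk S.f.hom S.g.hom δ ∈ distTriang D := by
  have := hS.epi_g
  have := hS.mono_f
  obtain ⟨X, i, δ, hT⟩ := AbelianSubcategory.exists_distinguished_triangle_of_epi hom_ι_eq_zero
    (admissibleMorphism_heart t) S.g
  have hk := AbelianSubcategory.isLimitKernelForkOfDistTriang hom_ι_eq_zero i S.g δ hT
  let e : S.X₁ ≅ X := IsLimit.conePointUniqueUpToIso hS.fIsKernel hk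
  have he : e.hom ≫ i = S.f :=
    IsLimit.conePointUniqueUpToIso_hom_comp hS.fIsKernel hk WalkingParallelPair.zero
  refine ⟨δ ≫ (t.heart.ι.map e.inv)⟦1⟧',
    distTriang_of_iso hT (t.heart.ι.mapIso e) (Iso.refl _) (Iso.refl _) ?_ ?_ ?_⟩
  · simp [← he]
  · simp
  · simp [← Functor.map_comp]

/-- A monomorphism of the heart has its cone in the heart. -/
lemma exists_distTriang_of_mono {X Y : t.heart.FullSubcategory} (f : X ⟶ Y) [Mono f] :
    ∃ (Q : D) (g : Y.obj ⟶ Q) (δ : Q ⟶ X.obj⟦(1 : ℤ)⟧),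
      Triangle.mk f.hom g δ ∈ distTriang D ∧ t.heart Q := by
  let _ := abelianHeart t
  have hS : (ShortComplex.mk f (cokernel.π f) (cokernel.condition f)).ShortExact :=
    { exact := ShortComplex.exact_of_g_is_cokernel _ (cokernelIsCokernel f) }
  obtain ⟨δ, hT⟩ := exists_distTriang_of_shortExact hS
  exact ⟨_, _, δ, hT, (cokernel f).property⟩

/-- The Gabriel product in the heart is the extension product in the triangulated category. -/
lemma gabrielProduct_inverseImage {P Q : ObjectProperty D} (hP : P ≤ t.heart)
    (hQ : Q ≤ t.heart) :
    gabrielProduct (P.inverseImage t.heart.ι) (Q.inverseImage t.heart.ι) =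
      (extensionProduct P Q).inverseImage t.heart.ι := by
  ext E
  constructor
  · rintro ⟨X, Y, i, p, w, hS, hX, hY⟩
    obtain ⟨δ, hT⟩ := exists_distTriang_of_shortExact hS
    exact ⟨_, _, _, _, δ, hT, hX, hY⟩
  · rintro ⟨X, Y, i, p, δ, hT, hX, hY⟩
    let X' : t.heart.FullSubcategory := ⟨X, hP X hX⟩
    let Y' : t.heart.FullSubcategory := ⟨Y, hQ Y hY⟩
    let i' : X' ⟶ E := t.heart.homMk i
    let p' : E ⟶ Y' := t.heart.homMk p
    have w : i' ≫ p' = 0 := by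
      ext
      exact comp_distTriang_mor_zero₁₂ _ hT
    exact ⟨X', Y', i', p', w, shortExact_of_distTriang _ _ hT w, hX, hY⟩

end HeartAbelian

/-! ### Simple objects and length in the heart -/

section Length

variable {D : Type u} [Category.{v} D] [Preadditive D] [HasZeroObject D] [HasShift D ℤ]
  [∀ n : ℤ, (shiftFunctor D n).Additive] [Pretriangulated D]

/-- A triangle on `Y ⟶ Q ⟶ S[1]` rotates back to a triangle on `S ⟶ Y ⟶ Q`. -/
lemma exists_distTriang_of_shift {S Y Q : D} {g : Y ⟶ Q} {h : Q ⟶ S⟦(1 : ℤ)⟧}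
    {w : S⟦(1 : ℤ)⟧ ⟶ Y⟦(1 : ℤ)⟧} (hT : Triangle.mk g h w ∈ distTriang D) :
    ∃ f : S ⟶ Y, Triangle.mk f g h ∈ distTriang D := by
  obtain ⟨f, hf⟩ := (shiftFunctor D (1 : ℤ)).map_surjective w
  refine ⟨-f, ?_⟩
  have hf' : -(-f)⟦(1 : ℤ)⟧' = w := by rw [Functor.map_neg, neg_neg, hf]
  refine (rotate_distinguished_triangle _).2 ?_
  change Triangle.mk g h (-(-f)⟦(1 : ℤ)⟧') ∈ distTriang D
  rwa [hf']

variable {t : TStructure D}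

/-- The first morphism of a distinguished triangle with vertices in the heart is a monomorphism
in the heart. -/
lemma eq_zero_of_comp_mor₁_eq_zero {X Y Z W : D} {f : X ⟶ Y} {g : Y ⟶ Z} {h : Z ⟶ X⟦(1 : ℤ)⟧}
    (hT : Triangle.mk f g h ∈ distTriang D) (hZ : t.heart Z) (hW : t.heart W)
    (k : W ⟶ X) (hk : k ≫ f = 0) : k = 0 := by
  obtain ⟨l, m, rfl⟩ := exists_lift_shift_of_comp_eq_zero hT k hk
  rw [hom_shift_eq_zero_of_neg hW hZ (by lia) l, zero_comp]

variable (t) in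
/-- The simple objects of the heart, as a property of objects of the triangulated category. -/
def simpleObjects : ObjectProperty D := fun S =>
  ∃ h : t.heart S, Simple (FullSubcategory.mk S h : t.heart.FullSubcategory)

instance : (simpleObjects t).IsClosedUnderIsomorphisms where
  of_iso {X Y} e := by
    rintro ⟨hX, hS⟩
    have hY := t.heart.prop_of_iso e hX
    exact ⟨hY, @Simple.of_iso _ _ _ (FullSubcategory.mk Y hY) ⟨X, hX⟩ hS
      (t.heart.isoMk (X := ⟨Y, hY⟩) (Y := ⟨X, hX⟩) e.symm)⟩

lemma not_isZero_of_simple {S : D} (hS : simpleObjects t S) : ¬ IsZero S := by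
  obtain ⟨h, hS⟩ := hS
  intro hz
  apply id_nonzero (FullSubcategory.mk S h : t.heart.FullSubcategory)
  ext
  exact hz.eq_of_src _ _

/-- Schur's lemma. -/
lemma isIso_of_simple_of_ne_zero {S S' : D} (hS : simpleObjects t S) (hS' : simpleObjects t S')
    (f : S ⟶ S') (hf : f ≠ 0) : IsIso f := by
  obtain ⟨h, hS⟩ := hS
  obtain ⟨h', hS'⟩ := hS'
  let f' : (FullSubcategory.mk S h : t.heart.FullSubcategory) ⟶ ⟨S', h'⟩ := t.heart.homMk f
  have hf' : f' ≠ 0 := fun H => hf (congrArg (fun k => k.hom) H)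
  have : IsIso f' := @isIso_of_hom_simple _ _ _ _ _ _ hS hS' _ hf'
  exact (inferInstance : IsIso f'.hom)

/-- The inclusion of a simple subobject is nonzero. -/
lemma mor₁_ne_zero_of_simple {S E Y : D} {f : S ⟶ E} {g : E ⟶ Y} {h : Y ⟶ S⟦(1 : ℤ)⟧}
    (hT : Triangle.mk f g h ∈ distTriang D) (hS : simpleObjects t S) (hY : t.heart Y) :
    f ≠ 0 := by
  rintro rfl
  apply not_isZero_of_simple hS
  rw [IsZero.iff_id_eq_zero]
  exact eq_zero_of_comp_mor₁_eq_zero hT hY hS.1 _ (by simp)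

variable (t) in
/-- The objects of the heart of length `n`: those with a filtration whose `n` successive
subquotients are simple. -/
def lengthProp : ℕ → ObjectProperty D
  | 0 => fun X => IsZero X
  | n + 1 => extensionProduct (simpleObjects t) (lengthProp n)

instance isClosedUnderIsomorphisms_isZero :
    ObjectProperty.IsClosedUnderIsomorphisms (fun X : D => IsZero X) where
  of_iso e h := h.of_iso e.symm

instance (n : ℕ) : (lengthProp t n).IsClosedUnderIsomorphisms := by
  cases n with
  | zero => exact isClosedUnderIsomorphisms_isZero
  | succ n => exact inferInstanceAs (extensionProduct _ _).IsClosedUnderIsomorphisms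

lemma lengthProp_le_heart (n : ℕ) : lengthProp t n ≤ t.heart := by
  induction n with
  | zero => exact fun X hX => heart_of_isZero t hX
  | succ n ih =>
    exact extensionProduct_le_of_isTriangulatedClosed₂ (fun _ h => h.1) ih

lemma isZero_extensionProduct (P : ObjectProperty D) [P.IsClosedUnderIsomorphisms] :
    extensionProduct (fun X : D => IsZero X) P = P := by
  apply le_antisymm
  · rintro X ⟨Y, Z, f, g, h, hT, hY, hZ⟩
    have : IsIso g := (Triangle.isZero₁_iff_isIso₂ _ hT).1 hY
    exact P.prop_of_iso (asIso g).symm hZ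
  · have : ObjectProperty.ContainsZero (fun X : D => IsZero X) := ⟨_, isZero_zero D, isZero_zero D⟩
    exact le_extensionProduct_right _

lemma extensionProduct_isZero (P : ObjectProperty D) [P.IsClosedUnderIsomorphisms] :
    extensionProduct P (fun X : D => IsZero X) = P := by
  apply le_antisymm
  · rintro X ⟨Y, Z, f, g, h, hT, hY, hZ⟩
    have : IsIso f := (Triangle.isZero₃_iff_isIso₁ _ hT).1 hZ
    exact P.prop_of_iso (asIso f) hY
  · have : ObjectProperty.ContainsZero (fun X : D => IsZero X) := ⟨_, isZero_zero D, isZero_zero D⟩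
    exact le_extensionProduct_left _

lemma isZero_of_lengthProp_of_isZero {n : ℕ} {X : D} (hX : lengthProp t n X) (h : IsZero X) :
    n = 0 := by
  cases n with
  | zero => rfl
  | succ n =>
    obtain ⟨S, Y, f, g, k, hT, hS, hY⟩ := hX
    exact absurd (h.eq_of_tgt _ _) (mor₁_ne_zero_of_simple hT hS (lengthProp_le_heart n _ hY))

end Length

section LengthTriangulated

variable {D : Type u} [Category.{v} D] [Preadditive D] [HasZeroObject D] [HasShift D ℤ]
  [∀ n : ℤ, (shiftFunctor D n).Additive] [Pretriangulated D] [IsTriangulated D]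

variable {t : TStructure D}

/-- Length is additive in short exact sequences. -/
lemma extensionProduct_lengthProp (m n : ℕ) :
    extensionProduct (lengthProp t m) (lengthProp t n) ≤ lengthProp t (m + n) := by
  induction m with
  | zero =>
    rw [Nat.zero_add]
    exact (isZero_extensionProduct _).le
  | succ m ih =>
    rw [Nat.add_right_comm]
    change extensionProduct (extensionProduct _ _) _ ≤ extensionProduct _ _
    rw [extensionProduct_assoc]
    exact monotone_extensionProduct_right _ ih

/-- A nonzero morphism from a simple object is a monomorphism of the heart. -/
lemma exists_distTriang_of_simple {S X : D} (hS : simpleObjects t S) (hX : t.heart X)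
    (f : S ⟶ X) (hf : f ≠ 0) :
    ∃ (Q : D) (g : X ⟶ Q) (h : Q ⟶ S⟦(1 : ℤ)⟧),
      Triangle.mk f g h ∈ distTriang D ∧ t.heart Q := by
  obtain ⟨h, hS⟩ := hS
  let f' : (FullSubcategory.mk S h : t.heart.FullSubcategory) ⟶ ⟨X, hX⟩ := t.heart.homMk f
  have hf' : f' ≠ 0 := fun H => hf (congrArg (fun k => k.hom) H)
  have : Mono f' := @mono_of_nonzero_from_simple _ _ _ _ _ _ hS _ hf'
  exact exists_distTriang_of_mono f'

variable (hfl : HasFiniteLength t.heart.FullSubcategory)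

include hfl

lemma exists_simple_distTriang {X : D} (hX : t.heart X) (h0 : ¬ IsZero X) :
    extensionProduct (simpleObjects t) t.heart X := by
  let X' : t.heart.FullSubcategory := ⟨X, hX⟩
  have := (hfl X').2
  have h0' : ¬ IsZero X' := fun h => h0 (t.heart.ι.map_isZero h)
  obtain ⟨Q, g, δ, hT, hQ⟩ := exists_distTriang_of_mono (simpleSubobjectArrow h0')
  exact ⟨_, Q, _, g, δ, hT,
    ⟨(simpleSubobject h0').property, inferInstanceAs (Simple (simpleSubobject h0'))⟩, hQ⟩

/-- Noetherian induction on the kernel `A` of a quotient `E ⟶ Y`: if `Y` is nonzero, dividing out a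
simple subobject of `Y` enlarges the kernel. -/
lemma exists_lengthProp_of_quotient (E : t.heart.FullSubcategory) (a : Subobject E) :
    ∀ (A : t.heart.FullSubcategory) (f : A ⟶ E) [Mono f], Subobject.mk f = a →
      ∀ (Y : D) (g : E.obj ⟶ Y) (δ : Y ⟶ A.obj⟦(1 : ℤ)⟧),
        Triangle.mk f.hom g δ ∈ distTriang D → t.heart Y → ∃ n, lengthProp t n Y := by
  have : IsNoetherianObject E := (hfl E).1
  induction a using WellFoundedGT.induction with
  | ind a ih =>
  rintro A f _ rfl Y g δ hT hY
  by_cases h0 : IsZero Y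
  · exact ⟨0, h0⟩
  obtain ⟨S, Y', i, p, h, hT', hS, hY'⟩ := exists_simple_distTriang hfl hY h0
  obtain ⟨A', j, δ', hT''⟩ := distinguished_cocone_triangle₁ (g ≫ p)
  let o := someOctahedron' rfl hT hT' hT''
  have hA' : t.heart A' := t.heart.ext_of_isTriangulatedClosed₂ _ o.mem A.property hS.1
  let A'' : t.heart.FullSubcategory := ⟨A', hA'⟩
  let Y'' : t.heart.FullSubcategory := ⟨Y', hY'⟩
  let j' : A'' ⟶ E := t.heart.homMk j
  let q : E ⟶ Y'' := t.heart.homMk (g ≫ p)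
  have hw : j' ≫ q = 0 := by
    ext
    exact comp_distTriang_mor_zero₁₂ _ hT''
  have : Mono j' := (shortExact_of_distTriang j' q hT'' hw).mono_f
  let m : A ⟶ A'' := t.heart.homMk o.m₁
  have hm : m ≫ j' = f := by
    ext
    exact o.comm₁
  have hlt : Subobject.mk f < Subobject.mk j' := by
    refine lt_of_le_of_ne (Subobject.mk_le_mk_of_comm m hm) fun heq => ?_
    have hiso : (Subobject.isoOfMkEqMk _ _ heq).hom = m := by
      rw [← cancel_mono j', hm]
      simp
    have : IsIso m := hiso ▸ inferInstance
    have : IsIso o.m₁ := (inferInstance : IsIso m.hom)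
    exact not_isZero_of_simple hS ((Triangle.isZero₃_iff_isIso₁ _ o.mem).2 this)
  obtain ⟨n, hn⟩ := ih _ hlt A'' j' rfl Y' _ _ hT'' hY'
  exact ⟨n + 1, S, Y', i, p, h, hT', hS, hn⟩

lemma exists_lengthProp {X : D} (hX : t.heart X) : ∃ n, lengthProp t n X := by
  let X' : t.heart.FullSubcategory := ⟨X, hX⟩
  let Z : t.heart.FullSubcategory := ⟨_, heart_of_isZero t (isZero_zero D)⟩
  let f : Z ⟶ X' := t.heart.homMk 0
  have : Mono f := ⟨fun _ _ _ => by ext⟩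
  exact exists_lengthProp_of_quotient hfl X' _ Z f rfl X (𝟙 X) 0
    (distTriang_of_iso (contractible_distinguished₁ X) (Iso.refl _) (Iso.refl _) (Iso.refl _)
      (by simp [f]) (by simp) (by simp)) hX

/-- The Jordan–Hölder theorem, for the number of simple factors. -/
lemma lengthProp_unique {m n : ℕ} {X : D} (hm : lengthProp t m X) (hn : lengthProp t n X) :
    m = n := by
  induction m generalizing n X with
  | zero => exact (isZero_of_lengthProp_of_isZero hn hm).symm
  | succ m ih =>
    cases n with
    | zero => exact isZero_of_lengthProp_of_isZero hm hn
    | succ n =>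
      obtain ⟨S, Y, f, g, h, hT, hS, hY⟩ := hm
      obtain ⟨S', Y', f', g', h', hT', hS', hY'⟩ := hn
      have hf := mor₁_ne_zero_of_simple hT hS (lengthProp_le_heart _ _ hY)
      congr 1
      by_cases hu : f ≫ g' = 0
      · -- The two simple subobjects coincide, hence so do the quotients.
        obtain ⟨a, ha⟩ := exists_lift_of_comp_eq_zero hT' f hu
        have : IsIso a := isIso_of_simple_of_ne_zero hS hS' a fun h0 => hf (by
          rw [← ha, h0, zero_comp])
        let e₁ : S ≅ S' := asIso a
        let e := isoTriangleOfIso₁₂ _ _ hT hT' e₁ (Iso.refl _) (by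
          exact (Category.comp_id _).trans ha.symm)
        exact ih ((lengthProp t m).prop_of_iso (Triangle.π₃.mapIso e) hY) hY'
      · -- Both quotients map onto the quotient of `X` by the sum of the two simple subobjects.
        obtain ⟨Q, v, w, hQ, hQ'⟩ := exists_distTriang_of_simple hS (lengthProp_le_heart _ _ hY')
          _ hu
        let o := someOctahedron rfl hT (rot_of_distTriang _ hT') hQ
        obtain ⟨k, hk⟩ := exists_lengthProp hfl hQ'
        obtain ⟨i, hi⟩ := exists_distTriang_of_shift o.mem
        have h₁ : lengthProp t (k + 1) Y := ⟨_, _, _, _, _, hi, hS', hk⟩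
        have h₂ : lengthProp t (k + 1) Y' := ⟨_, _, _, _, _, hQ, hS, hk⟩
        obtain rfl := ih hY h₁
        exact ih h₂ hY'

/-- A nonzero object of the heart has a simple quotient. -/
lemma exists_simple_quotient {X : D} (hX : t.heart X) (h0 : ¬ IsZero X) :
    extensionProduct t.heart (simpleObjects t) X := by
  obtain ⟨n, hn⟩ := exists_lengthProp hfl hX
  induction n generalizing X with
  | zero => exact absurd hn h0
  | succ n ih =>
    obtain ⟨S, Y, f, g, h, hT, hS, hY⟩ := hn
    by_cases hY0 : IsZero Y
    · have : IsIso f := (Triangle.isZero₃_iff_isIso₁ _ hT).1 hY0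
      exact le_extensionProduct_right _ _ ((simpleObjects t).prop_of_iso (asIso f) hS)
    · have : extensionProduct (simpleObjects t) (extensionProduct t.heart (simpleObjects t)) X :=
        ⟨_, _, _, _, _, hT, hS, ih (lengthProp_le_heart _ _ hY) hY0 hY⟩
      rw [← extensionProduct_assoc] at this
      exact monotone_extensionProduct_left _
        (extensionProduct_le_of_isTriangulatedClosed₂ (fun _ h => h.1) le_rfl) _ this

end LengthTriangulated

/-! ### Extension closures and torsion pairs in the heart, inside the triangulated category -/

section Torsion

variable {D : Type u} [Category.{v} D] [Preadditive D] [HasZeroObject D] [HasShift D ℤ]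
  [∀ n : ℤ, (shiftFunctor D n).Additive] [Pretriangulated D]

/-- The smallest property of objects of `D` which contains `P` and the zero objects and is closed
under extensions by distinguished triangles. -/
inductive triangulatedClosure (P : ObjectProperty D) : ObjectProperty D
  | zero (X : D) (hX : IsZero X) : triangulatedClosure P X
  | of (X : D) (hX : P X) : triangulatedClosure P X
  | ext {X E Y : D} (f : X ⟶ E) (g : E ⟶ Y) (h : Y ⟶ X⟦(1 : ℤ)⟧)
      (hT : Triangle.mk f g h ∈ distTriang D)
      (hX : triangulatedClosure P X) (hY : triangulatedClosure P Y) : triangulatedClosure P E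

instance (P : ObjectProperty D) : (triangulatedClosure P).IsClosedUnderIsomorphisms where
  of_iso {X Y} e hX :=
    have : Triangle.mk e.hom (0 : Y ⟶ _) 0 ∈ distTriang D :=
      distTriang_of_iso (contractible_distinguished X) (Iso.refl _) e.symm
        (Iso.refl _) (by simp) (by simp) (by simp)
    .ext _ _ _ this hX (.zero _ (isZero_zero D))

lemma triangulatedClosure_le {P Q : ObjectProperty D} [Q.IsTriangulatedClosed₂]
    [Q.IsClosedUnderIsomorphisms] [Q.ContainsZero] (h : P ≤ Q) : triangulatedClosure P ≤ Q := by
  intro X hX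
  induction hX with
  | zero X hX => exact Q.prop_of_isZero hX
  | of X hX => exact h X hX
  | ext f g h hT _ _ hX hY => exact Q.ext_of_isTriangulatedClosed₂ _ hT hX hY

instance (P : ObjectProperty D) : (triangulatedClosure P).IsTriangulatedClosed₂ :=
  .mk' fun _ hT h₁ h₃ => .ext _ _ _ hT h₁ h₃

instance (P : ObjectProperty D) : (triangulatedClosure P).ContainsZero :=
  ⟨_, isZero_zero D, .zero _ (isZero_zero D)⟩

/-- A torsion pair `(T, F)` in the heart of `t`, as a pair of properties of objects of `D`. -/
structure IsTorsionPairIn (t : TStructure D) (T F : ObjectProperty D) : Prop where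
  isClosedUnderIsomorphisms_left : T.IsClosedUnderIsomorphisms
  isClosedUnderIsomorphisms_right : F.IsClosedUnderIsomorphisms
  left_le : T ≤ t.heart
  right_le : F ≤ t.heart
  hom_eq_zero : ∀ ⦃X Y : D⦄, T X → F Y → ∀ f : X ⟶ Y, f = 0
  heart_le : t.heart ≤ extensionProduct T F

namespace IsTorsionPairIn

variable {t : TStructure D} {T F : ObjectProperty D} (h : IsTorsionPairIn t T F)

include h

/-- The torsion class is the left orthogonal of the torsion-free class. -/
lemma mem_left {X : D} (hX : t.heart X) (h0 : ∀ Y : D, F Y → ∀ f : X ⟶ Y, f = 0) : T X := by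
  have := h.isClosedUnderIsomorphisms_left
  obtain ⟨P, Q, f, g, k, hT, hP, hQ⟩ := h.heart_le X hX
  have hQ0 : IsZero Q := by
    rw [IsZero.iff_id_eq_zero]
    obtain ⟨l, hl⟩ := exists_desc_shift_of_comp_eq_zero hT (𝟙 Q) (by simp [h0 Q hQ g])
    rw [← hl, hom_eq_zero_of_le_of_ge (shift_one_le (h.left_le _ hP)) (h.right_le _ hQ).2
      (by lia) l, comp_zero]
  have : IsIso f := (Triangle.isZero₃_iff_isIso₁ _ hT).1 hQ0
  exact T.prop_of_iso (asIso f) hP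

/-- The torsion-free class is the right orthogonal of the torsion class. -/
lemma mem_right {Y : D} (hY : t.heart Y) (h0 : ∀ X : D, T X → ∀ f : X ⟶ Y, f = 0) : F Y := by
  have := h.isClosedUnderIsomorphisms_right
  obtain ⟨P, Q, f, g, k, hT, hP, hQ⟩ := h.heart_le Y hY
  have hP0 : IsZero P := by
    rw [IsZero.iff_id_eq_zero]
    exact eq_zero_of_comp_mor₁_eq_zero hT (h.right_le _ hQ) (h.left_le _ hP) _
      (by simp [h0 P hP f])
  have : IsIso g := (Triangle.isZero₁_iff_isIso₂ _ hT).1 hP0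
  exact F.prop_of_iso (asIso g).symm hQ

lemma containsZero_left : T.ContainsZero :=
  ⟨_, isZero_zero D, h.mem_left (heart_of_isZero t (isZero_zero D))
    fun _ _ _ => (isZero_zero D).eq_of_src _ _⟩

lemma containsZero_right : F.ContainsZero :=
  ⟨_, isZero_zero D, h.mem_right (heart_of_isZero t (isZero_zero D))
    fun _ _ _ => (isZero_zero D).eq_of_tgt _ _⟩

lemma isTriangulatedClosed₂_left : T.IsTriangulatedClosed₂ := by
  have := h.isClosedUnderIsomorphisms_left
  refine .mk' fun Δ hΔ h₁ h₃ => h.mem_left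
    (t.heart.ext_of_isTriangulatedClosed₂ _ hΔ (h.left_le _ h₁) (h.left_le _ h₃)) fun Y hY f => ?_
  obtain ⟨l, rfl⟩ := exists_desc_of_comp_eq_zero hΔ f (h.hom_eq_zero h₁ hY _)
  rw [h.hom_eq_zero h₃ hY l, comp_zero]

/-- A torsion class is closed under quotients. -/
lemma left_of_distTriang {X Y Z : D} {f : X ⟶ Y} {g : Y ⟶ Z} {k : Z ⟶ X⟦(1 : ℤ)⟧}
    (hT : Triangle.mk f g k ∈ distTriang D) (hX : t.heart X) (hY : T Y) (hZ : t.heart Z) :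
    T Z := by
  refine h.mem_left hZ fun W hW a => ?_
  obtain ⟨l, rfl⟩ := exists_desc_shift_of_comp_eq_zero hT a (h.hom_eq_zero hY hW _)
  rw [hom_eq_zero_of_le_of_ge (shift_one_le hX) (h.right_le _ hW).2 (by lia) l, comp_zero]

end IsTorsionPairIn

end Torsion

section SimpleTorsion

variable {D : Type u} [Category.{v} D] [Preadditive D] [HasZeroObject D] [HasShift D ℤ]
  [∀ n : ℤ, (shiftFunctor D n).Additive] [Pretriangulated D]

/-- The torsion-free class `{E | Hom(S, E) = 0}` in the heart of `t`. -/
def rightOrthogonalIn (t : TStructure D) (S : D) : ObjectProperty D := fun X =>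
  t.heart X ∧ ∀ f : S ⟶ X, f = 0

/-- The extension closure of `S` in `D`. -/
abbrev closureOf (S : D) : ObjectProperty D :=
  triangulatedClosure (ObjectProperty.singleton S)

lemma closureOf_self (S : D) : closureOf S S := .of _ (by simp)

lemma closureOf_le {Q : ObjectProperty D} [Q.IsTriangulatedClosed₂]
    [Q.IsClosedUnderIsomorphisms] [Q.ContainsZero] {S : D} (hS : Q S) : closureOf S ≤ Q :=
  triangulatedClosure_le (by rintro X hX; obtain rfl := (by simpa using hX); exact hS)

/-- Morphisms out of `⟨S⟩` vanish as soon as morphisms out of `S` do. -/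
lemma hom_closureOf_eq_zero {S X Y : D} (hX : closureOf S X) (hY : ∀ f : S ⟶ Y, f = 0)
    (f : X ⟶ Y) : f = 0 := by
  induction hX with
  | zero X hX => exact hX.eq_of_src _ _
  | of X hX => obtain rfl := (by simpa using hX); exact hY f
  | ext _ _ _ hT _ _ h₁ h₃ =>
    obtain ⟨l, rfl⟩ := exists_desc_of_comp_eq_zero hT f (h₁ _)
    rw [h₃ l, comp_zero]

variable [IsTriangulated D] {t : TStructure D}

/-- A simple object `S` defines a torsion pair. The decomposition of `X` is found by induction on
the length: if there is a nonzero morphism `S ⟶ X`, it is a monomorphism, and `X / S` is shorter. -/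
lemma isTorsionPairIn_simple (hfl : HasFiniteLength t.heart.FullSubcategory) {S : D}
    (hS : simpleObjects t S) : IsTorsionPairIn t (closureOf S) (rightOrthogonalIn t S) where
  isClosedUnderIsomorphisms_left := inferInstance
  isClosedUnderIsomorphisms_right :=
    ⟨fun {X Y} e hX => ⟨t.heart.prop_of_iso e hX.1, fun f => by
      rw [← cancel_mono e.inv, hX.2 (f ≫ e.inv), zero_comp]⟩⟩
  left_le := closureOf_le hS.1
  right_le _ hX := hX.1
  hom_eq_zero _ _ hX hY f := hom_closureOf_eq_zero hX hY.2 f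
  heart_le := by
    intro X hX
    obtain ⟨n, hn⟩ := exists_lengthProp hfl hX
    induction n generalizing X with
    | zero =>
      exact ⟨_, _, _, _, _, contractible_distinguished X, .zero _ hn,
        heart_of_isZero t (isZero_zero D), fun _ => (isZero_zero D).eq_of_tgt _ _⟩
    | succ n ih =>
      by_cases hX0 : ∀ f : S ⟶ X, f = 0
      · exact le_extensionProduct_right _ _ ⟨hX, hX0⟩
      · obtain ⟨f, hf⟩ := not_forall.1 hX0
        obtain ⟨Q, g, h, hT, hQ⟩ := exists_distTriang_of_simple hS hX f hf
        obtain ⟨k, hk⟩ := exists_lengthProp hfl hQ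
        have hk' : k + 1 = n + 1 := lengthProp_unique hfl ⟨_, _, _, _, _, hT, hS, hk⟩ hn
        obtain rfl : k = n := by lia
        have : extensionProduct (closureOf S)
            (extensionProduct (closureOf S) (rightOrthogonalIn t S)) X :=
          ⟨_, _, _, _, _, hT, closureOf_self S, ih Q hQ hk⟩
        rw [← extensionProduct_assoc] at this
        exact monotone_extensionProduct_left _
          (extensionProduct_le_of_isTriangulatedClosed₂ le_rfl le_rfl) _ this

/-- The extension closure of an object of the heart is the same in the heart and in the
triangulated category. -/
lemma generatedBy_eq_inverseImage (S : t.heart.FullSubcategory) :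
    generatedBy S = (closureOf S.obj).inverseImage t.heart.ι := by
  ext X
  constructor
  · intro h
    induction h with
    | zero X hX => exact .zero _ (t.heart.ι.map_isZero hX)
    | of X hX => obtain rfl := (by simpa using hX); exact closureOf_self _
    | ext i p w hS _ _ hX hY =>
      obtain ⟨δ, hT⟩ := exists_distTriang_of_shortExact hS
      exact .ext _ _ _ hT hX hY
  · intro h
    suffices H : ∀ X : D, closureOf S.obj X → ∃ hX : t.heart X, generatedBy S ⟨X, hX⟩ from
      (H _ h).2
    intro X hX
    induction hX with
    | zero X hX =>
      refine ⟨heart_of_isZero t hX, .zero _ ?_⟩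
      rw [IsZero.iff_id_eq_zero]
      ext
      exact hX.eq_of_src _ _
    | of X hX =>
      obtain rfl := (by simpa using hX)
      exact ⟨S.property, .of _ (by simp)⟩
    | @ext X E Y f g k hT _ _ hX hY =>
      obtain ⟨hX, hX'⟩ := hX
      obtain ⟨hY, hY'⟩ := hY
      have hE : t.heart E := t.heart.ext_of_isTriangulatedClosed₂ _ hT hX hY
      let i : (FullSubcategory.mk X hX : t.heart.FullSubcategory) ⟶ ⟨E, hE⟩ := t.heart.homMk f
      let p : (FullSubcategory.mk E hE : t.heart.FullSubcategory) ⟶ ⟨Y, hY⟩ := t.heart.homMk g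
      have w : i ≫ p = 0 := by
        ext
        exact comp_distTriang_mor_zero₁₂ _ hT
      exact ⟨hE, .ext i p w (shortExact_of_distTriang i p hT w) hX' hY'⟩

lemma map_generatedBy (S : t.heart.FullSubcategory) :
    (generatedBy S).map t.heart.ι = closureOf S.obj := by
  ext X
  constructor
  · rintro ⟨Y, hY, ⟨e⟩⟩
    rw [generatedBy_eq_inverseImage] at hY
    exact (closureOf S.obj).prop_of_iso e hY
  · intro hX
    have h : t.heart X := closureOf_le S.property X hX
    refine ⟨⟨X, h⟩, ?_, ⟨Iso.refl _⟩⟩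
    rw [generatedBy_eq_inverseImage]
    exact hX

end SimpleTorsion

/-! ### The tilted t-structure -/

section Tilt

variable {D : Type u} [Category.{v} D] [Preadditive D] [HasZeroObject D] [HasShift D ℤ]
  [∀ n : ℤ, (shiftFunctor D n).Additive] [Pretriangulated D]

lemma shift_extensionProduct_le (P Q : ObjectProperty D) [P.IsClosedUnderIsomorphisms]
    [Q.IsClosedUnderIsomorphisms] (a : ℤ) :
    (extensionProduct P Q).shift a ≤ extensionProduct (P.shift a) (Q.shift a) := by
  rintro X ⟨Y, Z, f, g, h, hT, hY, hZ⟩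
  refine prop_of_iso _ ((shiftEquiv D a).unitIso.symm.app X)
    ⟨Y⟦-a⟧, Z⟦-a⟧, _, _, _, Triangle.shift_distinguished _ hT (-a), ?_, ?_⟩
  · exact P.prop_of_iso ((shiftEquiv D a).counitIso.symm.app Y) hY
  · exact Q.prop_of_iso ((shiftEquiv D a).counitIso.symm.app Z) hZ

lemma shift_extensionProduct (P Q : ObjectProperty D) [P.IsClosedUnderIsomorphisms]
    [Q.IsClosedUnderIsomorphisms] (a : ℤ) :
    (extensionProduct P Q).shift a = extensionProduct (P.shift a) (Q.shift a) := by
  apply le_antisymm (shift_extensionProduct_le P Q a)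
  have h := shift_extensionProduct_le (P.shift a) (Q.shift a) (-a)
  rw [shift_shift P (-a) a 0 (by lia), shift_shift Q (-a) a 0 (by lia), shift_zero,
    shift_zero] at h
  intro X hX
  rw [← shift_zero (extensionProduct (P.shift a) (Q.shift a)) ℤ,
    ← shift_shift _ a (-a) 0 (by lia)] at hX
  exact h _ hX

variable {t : TStructure D} {T F : ObjectProperty D}

namespace IsTorsionPairIn

lemma left_shift_le_ge (h : IsTorsionPairIn t T F) : T.shift (1 : ℤ) ≤ t.ge 1 := by
  rw [← t.shift_ge 1 0 1 (by lia)]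
  exact fun X hX => (h.left_le _ hX).2

lemma left_shift_le_le (h : IsTorsionPairIn t T F) : T.shift (1 : ℤ) ≤ t.le 1 := by
  rw [← t.shift_le 1 0 1 (by lia)]
  exact fun X hX => (h.left_le _ hX).1

lemma right_shift_le_ge (h : IsTorsionPairIn t T F) : F.shift (1 : ℤ) ≤ t.ge 1 := by
  rw [← t.shift_ge 1 0 1 (by lia)]
  exact fun X hX => (h.right_le _ hX).2

/-- The objects `X` with `Hⁱ(X) = 0` for `i > 1` and `H¹(X)` in `T`. -/
abbrev tiltLE (t : TStructure D) (T : ObjectProperty D) : ObjectProperty D :=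
  extensionProduct (t.le 0) (T.shift (1 : ℤ))

/-- The objects `X` with `Hⁱ(X) = 0` for `i < 1` and `H¹(X)` in `F`. -/
abbrev tiltGE (t : TStructure D) (F : ObjectProperty D) : ObjectProperty D :=
  extensionProduct (F.shift (1 : ℤ)) (t.ge 2)

lemma tiltLE_le (h : IsTorsionPairIn t T F) : tiltLE t T ≤ t.le 1 :=
  extensionProduct_le_of_isTriangulatedClosed₂ (t.le_monotone (by lia)) h.left_shift_le_le

lemma tiltGE_le (h : IsTorsionPairIn t T F) : tiltGE t F ≤ t.ge 1 :=
  extensionProduct_le_of_isTriangulatedClosed₂ h.right_shift_le_ge (t.ge_antitone (by lia))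

lemma le_tiltLE (h : IsTorsionPairIn t T F) : t.le 0 ≤ tiltLE t T := by
  have := h.containsZero_left
  have := h.isClosedUnderIsomorphisms_left
  have : (T.shift (1 : ℤ)).ContainsZero :=
    ⟨_, isZero_zero D, T.prop_of_isZero ((shiftFunctor D (1 : ℤ)).map_isZero (isZero_zero D))⟩
  exact le_extensionProduct_left _

lemma ge_le_tiltGE (h : IsTorsionPairIn t T F) : t.ge 2 ≤ tiltGE t F := by
  have := h.containsZero_right
  have := h.isClosedUnderIsomorphisms_right
  have : (F.shift (1 : ℤ)).ContainsZero :=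
    ⟨_, isZero_zero D, F.prop_of_isZero ((shiftFunctor D (1 : ℤ)).map_isZero (isZero_zero D))⟩
  exact le_extensionProduct_right _

lemma hom_tilt_eq_zero (h : IsTorsionPairIn t T F) {X Y : D} (hX : tiltLE t T X)
    (hY : tiltGE t F Y) (f : X ⟶ Y) : f = 0 := by
  obtain ⟨A, B, i, p, _, hT, hA, hB⟩ := hX
  obtain ⟨A', B', i', p', _, hT', hA', hB'⟩ := id hY
  obtain ⟨l, rfl⟩ := exists_desc_of_comp_eq_zero hT f
    (hom_eq_zero_of_le_of_ge hA (h.tiltGE_le _ hY) (by lia) _)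
  obtain ⟨m, rfl⟩ := exists_lift_of_comp_eq_zero hT' l
    (hom_eq_zero_of_le_of_ge (h.left_shift_le_le _ hB) hB' (by lia) _)
  have : m = 0 := (shiftFunctor D (1 : ℤ)).map_injective (by
    rw [Functor.map_zero]
    exact h.hom_eq_zero hB hA' _)
  simp [this]

variable [IsTriangulated D]

/-- An object `X ≤ 1` is cut first at degree `0` and then along the torsion pair in `H¹(X)`. -/
lemma le_one_le (h : IsTorsionPairIn t T F) :
    t.le 1 ≤ extensionProduct (tiltLE t T) (F.shift (1 : ℤ)) := by
  have := h.isClosedUnderIsomorphisms_left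
  have := h.isClosedUnderIsomorphisms_right
  intro X hX
  obtain ⟨Y, Z, hY, hZ, f, g, k, hT⟩ := t.exists_triangle X 0 1 (by lia)
  have hZ' : t.le 1 Z := le_of_distTriang₃ hT (t.le_monotone (by lia) _ hY) hX
  rw [extensionProduct_assoc]
  exact ⟨Y, Z, f, g, k, hT, hY,
    shift_extensionProduct_le T F 1 _ (h.heart_le _ (heart_shift_one_of hZ' hZ))⟩

/-- The t-structure obtained by tilting at a torsion pair. -/
def tilt (h : IsTorsionPairIn t T F) : TStructure D :=
  have hT := h.isClosedUnderIsomorphisms_left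
  have hF := h.isClosedUnderIsomorphisms_right
  { le n := (tiltLE t T).shift n
    ge n := (tiltGE t F).shift (n - 1)
    le_shift n a n' hn X hX := by
      change ((tiltLE t T).shift n').shift a X
      rwa [shift_shift _ a n' n hn]
    ge_shift n a n' hn X hX := by
      change ((tiltGE t F).shift (n' - 1)).shift a X
      rwa [shift_shift _ a (n' - 1) (n - 1) (by lia)]
    zero' X Y f hX hY := by
      rw [shift_zero] at hX
      rw [sub_self, shift_zero] at hY
      exact h.hom_tilt_eq_zero hX hY f
    le_zero_le := by
      rw [shift_zero]
      exact fun X hX => h.le_tiltLE _ (t.le_shift 1 1 0 (by lia) X (h.tiltLE_le X hX))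
    ge_one_le := by
      rw [sub_self, shift_zero]
      exact fun X hX => h.ge_le_tiltGE _ (t.ge_shift 1 (0 - 1) 2 (by lia) X (h.tiltGE_le X hX))
    exists_triangle_zero_one A := by
      rw [sub_self, shift_zero, shift_zero]
      obtain ⟨X, Y, hX, hY, f, g, k, hT⟩ := t.exists_triangle A 1 2 (by lia)
      have hA : extensionProduct (extensionProduct (tiltLE t T) (F.shift (1 : ℤ))) (t.ge 2) A :=
        ⟨X, Y, f, g, k, hT, h.le_one_le X hX, hY⟩
      rw [extensionProduct_assoc] at hA
      obtain ⟨X', Y', f', g', k', hT', hX', hY'⟩ := hA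
      exact ⟨X', Y', hX', hY', f', g', k', hT'⟩ }

lemma tilt_le_zero (h : IsTorsionPairIn t T F) : h.tilt.le 0 = tiltLE t T := by
  change (tiltLE t T).shift 0 = _
  exact shift_zero _ ℤ

lemma tilt_ge_zero (h : IsTorsionPairIn t T F) : h.tilt.ge 0 = extensionProduct F (t.ge 1) := by
  have hT := h.isClosedUnderIsomorphisms_left
  have hF := h.isClosedUnderIsomorphisms_right
  change (tiltGE t F).shift (0 - 1) = _
  rw [shift_extensionProduct, shift_shift _ (0 - 1) 1 0 (by lia), shift_zero,
    t.shift_ge (0 - 1) 2 1 (by lia)]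

lemma heart_tilt (h : IsTorsionPairIn t T F) :
    h.tilt.heart = extensionProduct F (T.shift (1 : ℤ)) := by
  have hT := h.isClosedUnderIsomorphisms_left
  apply le_antisymm
  · rintro X ⟨hX, hX'⟩
    rw [tilt_le_zero] at hX
    rw [tilt_ge_zero] at hX'
    obtain ⟨U, V, f, g, k, hT₁, hU, hV⟩ := hX
    obtain ⟨P, Q, f', g', k', hT₂, hP, hQ⟩ := hX'
    -- Both triangles are the truncation triangle of `X` with respect to `t`.
    obtain ⟨e, -⟩ := t.triangle_iso_exists hT₁ hT₂ (Iso.refl _) 0 1 ⟨hU⟩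
      ⟨h.left_shift_le_ge _ hV⟩ ⟨(h.right_le _ hP).1⟩ ⟨hQ⟩
    exact ⟨P, Q, f', g', k', hT₂, hP,
      (T.shift (1 : ℤ)).prop_of_iso (Triangle.π₃.mapIso e) hV⟩
  · intro X hX
    refine ⟨?_, ?_⟩
    · rw [tilt_le_zero]
      exact monotone_extensionProduct_left _ (fun Y hY => (h.right_le _ hY).1) _ hX
    · rw [tilt_ge_zero]
      exact monotone_extensionProduct_right _ h.left_shift_le_ge _ hX

end IsTorsionPairIn

variable [IsTriangulated D]

/-- The simple tilt is the heart of the tilted t-structure. -/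
lemma simpleTilt_eq_heart_tilt {S : t.heart.FullSubcategory}
    (h : IsTorsionPairIn t (closureOf S.obj) (rightOrthogonalIn t S.obj)) :
    simpleTilt t.heart S = h.tilt.heart := by
  have := h.isClosedUnderIsomorphisms_right
  have hF : ObjectProperty.map (fun E : t.heart.FullSubcategory => ∀ f : S ⟶ E, f = 0)
      t.heart.ι = rightOrthogonalIn t S.obj := by
    ext X
    constructor
    · rintro ⟨Y, hY, ⟨e⟩⟩
      exact prop_of_iso _ e ⟨Y.property, fun f =>
        congrArg (fun k => k.hom) (hY (t.heart.homMk f))⟩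
    · rintro ⟨hX, hX'⟩
      refine ⟨⟨X, hX⟩, fun f => ?_, ⟨Iso.refl _⟩⟩
      ext
      exact hX' _
  rw [h.heart_tilt, simpleTilt, leftTilt, hF, map_generatedBy]

end Tilt

/-! ### The Euler characteristic with respect to a heart of finite length -/

section Euler

variable {D : Type u} [Category.{v} D] [Preadditive D] [HasZeroObject D] [HasShift D ℤ]
  [∀ n : ℤ, (shiftFunctor D n).Additive] [Pretriangulated D]

/-- The objects `X` with cohomology only in degrees `-1` and `0` and with
`length H⁰(X) - length H⁻¹(X) = k`. -/
def eulerProp (t : TStructure D) (k : ℤ) : ObjectProperty D := fun X =>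
  ∃ a c : ℕ, k = c - a ∧
    extensionProduct ((lengthProp t a).shift (-1 : ℤ)) (lengthProp t c) X

variable {t : TStructure D}

lemma eulerProp_of_lengthProp {n : ℕ} {X : D} (hX : lengthProp t n X) : eulerProp t n X := by
  have : ((lengthProp t 0).shift (-1 : ℤ)).ContainsZero :=
    ⟨_, isZero_zero D, (shiftFunctor D (-1 : ℤ)).map_isZero (isZero_zero D)⟩
  exact ⟨0, n, by simp, le_extensionProduct_right _ _ hX⟩

lemma eulerProp_neg_of_lengthProp {n : ℕ} {X : D} (hX : lengthProp t n (X⟦(-1 : ℤ)⟧)) :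
    eulerProp t (-n) X := by
  have : (lengthProp t 0).ContainsZero := ⟨_, isZero_zero D, isZero_zero D⟩
  exact ⟨n, 0, by simp, le_extensionProduct_left _ _ hX⟩

lemma lengthProp_shift_le (n : ℕ) : (lengthProp t n).shift (-1 : ℤ) ≤ t.le (-1) := by
  rw [← t.shift_le (-1) 0 (-1) (by lia)]
  exact fun X hX => (lengthProp_le_heart n _ hX).1

lemma lengthProp_shift_ge (n : ℕ) : (lengthProp t n).shift (-1 : ℤ) ≤ t.ge (-1) := by
  rw [← t.shift_ge (-1) 0 (-1) (by lia)]
  exact fun X hX => (lengthProp_le_heart n _ hX).2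

lemma lengthProp_shift_shift {a : ℕ} {A : D} (hA : lengthProp t a A) :
    lengthProp t a (A⟦(1 : ℤ)⟧⟦(-1 : ℤ)⟧) :=
  (lengthProp t a).prop_of_iso ((shiftEquiv D (1 : ℤ)).unitIso.app A) hA

variable [IsTriangulated D] (hfl : HasFiniteLength t.heart.FullSubcategory)

include hfl

lemma exists_extensionProduct_lengthProp {X : D} (h₁ : t.le 0 X) (h₂ : t.ge (-1) X) :
    ∃ (A C : D) (f : A⟦(1 : ℤ)⟧ ⟶ X) (g : X ⟶ C) (h : C ⟶ A⟦(1 : ℤ)⟧⟦(1 : ℤ)⟧) (a c : ℕ),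
      Triangle.mk f g h ∈ distTriang D ∧ lengthProp t a A ∧ lengthProp t c C := by
  obtain ⟨A, C, f, g, h, hT, hA, hC⟩ := exists_distTriang_of_le_of_ge h₁ h₂
  obtain ⟨a, ha⟩ := exists_lengthProp hfl hA
  obtain ⟨c, hc⟩ := exists_lengthProp hfl hC
  exact ⟨A, C, f, g, h, a, c, hT, ha, hc⟩

lemma exists_eulerProp {X : D} (h₁ : t.le 0 X) (h₂ : t.ge (-1) X) : ∃ k, eulerProp t k X := by
  obtain ⟨A, C, f, g, h, a, c, hT, ha, hc⟩ := exists_extensionProduct_lengthProp hfl h₁ h₂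
  exact ⟨c - a, a, c, rfl, _, _, f, g, h, hT, lengthProp_shift_shift ha, hc⟩

lemma eulerProp_unique {k l : ℤ} {X : D} (hk : eulerProp t k X) (hl : eulerProp t l X) :
    k = l := by
  obtain ⟨a, c, rfl, A, C, f, g, h, hT, hA, hC⟩ := hk
  obtain ⟨a', c', rfl, A', C', f', g', h', hT', hA', hC'⟩ := hl
  obtain ⟨e, -⟩ := t.triangle_iso_exists hT hT' (Iso.refl _) (-1) 0
    ⟨lengthProp_shift_le _ _ hA⟩ ⟨(lengthProp_le_heart _ _ hC).2⟩
    ⟨lengthProp_shift_le _ _ hA'⟩ ⟨(lengthProp_le_heart _ _ hC').2⟩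
  have h₁ := ((lengthProp t a).shift (-1 : ℤ)).prop_of_iso (Triangle.π₁.mapIso e) hA
  have h₃ := (lengthProp t c).prop_of_iso (Triangle.π₃.mapIso e) hC
  rw [lengthProp_unique hfl h₁ hA', lengthProp_unique hfl h₃ hC']

lemma length_eq_add {X Y Z : D} {f : X ⟶ Y} {g : Y ⟶ Z} {h : Z ⟶ X⟦(1 : ℤ)⟧}
    (hT : Triangle.mk f g h ∈ distTriang D) {a b c : ℕ} (hX : lengthProp t a X)
    (hY : lengthProp t b Y) (hZ : lengthProp t c Z) : b = a + c :=
  lengthProp_unique hfl hY (extensionProduct_lengthProp a c _ ⟨_, _, _, _, _, hT, hX, hZ⟩)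

/-- An extension `E` of `B[1]` by `C`, with `B` and `C` in the heart, is the cone of a morphism
`B ⟶ C`; its cohomology objects are the kernel `A` and the cokernel `C'` of this morphism, whose
image `K` accounts for the equality of lengths. -/
lemma exists_swap {b c : ℕ} {E : D}
    (hE : extensionProduct (lengthProp t c) ((lengthProp t b).shift (-1 : ℤ)) E) :
    ∃ a' c' : ℕ, c' + b = c + a' ∧
      extensionProduct ((lengthProp t a').shift (-1 : ℤ)) (lengthProp t c') E := by
  obtain ⟨C, Z, i, p, δ, hT, hC, hZ⟩ := hE
  have hC₀ := lengthProp_le_heart _ _ hC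
  have hZle := lengthProp_shift_le _ _ hZ
  have hZge := lengthProp_shift_ge _ _ hZ
  obtain ⟨A, C', f, g, h, a', c', hT', hA, hC'⟩ := exists_extensionProduct_lengthProp hfl
    ((t.le 0).ext_of_isTriangulatedClosed₂ _ hT hC₀.1 (t.le_monotone (by lia) _ hZle))
    ((t.ge (-1)).ext_of_isTriangulatedClosed₂ _ hT (t.ge_antitone (by lia) _ hC₀.2) hZge)
  have hA₀ := lengthProp_le_heart _ _ hA
  have hC'₀ := lengthProp_le_heart _ _ hC'
  obtain ⟨G, q, r, hG⟩ := distinguished_cocone_triangle (i ≫ g)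
  let o := someOctahedron rfl hT (rot_of_distTriang _ hT') hG
  obtain ⟨s, hs⟩ := exists_distTriang_of_shift o.mem
  have hGge : t.ge (-1) G :=
    ge_of_distTriang₃ hG hC₀.2 (t.ge_antitone (by lia) _ hC'₀.2)
  have hGle : t.le (-1) G :=
    le_of_distTriang₃ hs (t.le_monotone (by lia) _ (shift_one_le hA₀)) hZle
  obtain ⟨k, hK⟩ := exists_lengthProp hfl (heart_shift_neg_one_of hGle hGge)
  have h₁ : c = k + c' := length_eq_add hfl (inv_rot_of_distTriang _ hG) hK hC hC'
  have h₂ : b = a' + k := length_eq_add hfl (Triangle.shift_distinguished _ hs (-1))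
    (lengthProp_shift_shift hA) hZ hK
  exact ⟨a', c', by lia, _, _, f, g, h, hT', lengthProp_shift_shift hA, hC'⟩

/-- The Euler characteristic is additive in distinguished triangles. -/
lemma eulerProp_add {X Y Z : D} {f : X ⟶ Y} {g : Y ⟶ Z} {h : Z ⟶ X⟦(1 : ℤ)⟧}
    (hT : Triangle.mk f g h ∈ distTriang D) {k l : ℤ} (hX : eulerProp t k X)
    (hZ : eulerProp t l Z) : eulerProp t (k + l) Y := by
  obtain ⟨a, c, rfl, hX⟩ := hX
  obtain ⟨b, d, rfl, hZ⟩ := hZ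
  have hY : extensionProduct (extensionProduct _ _) (extensionProduct _ _) Y :=
    ⟨_, _, _, _, _, hT, hX, hZ⟩
  rw [extensionProduct_assoc, ← extensionProduct_assoc (lengthProp t c)] at hY
  obtain ⟨U, W, i, p, δ, hT₁, hU, V, Q, i', p', δ', hT₂, hV, hQ⟩ := hY
  obtain ⟨a', c', hac, hV⟩ := exists_swap hfl hV
  have hW : extensionProduct (extensionProduct ((lengthProp t a').shift (-1 : ℤ))
      (lengthProp t c')) (lengthProp t d) W := ⟨_, _, _, _, _, hT₂, hV, hQ⟩
  rw [extensionProduct_assoc] at hW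
  have hY : extensionProduct ((lengthProp t a).shift (-1 : ℤ)) (extensionProduct _ _) Y :=
    ⟨_, _, _, _, _, hT₁, hU, hW⟩
  rw [← extensionProduct_assoc, ← shift_extensionProduct] at hY
  refine ⟨a + a', c' + d, by push_cast; lia, ?_⟩
  exact monotone_extensionProduct_left _ (fun V hV => extensionProduct_lengthProp a a' _ hV) _
    (monotone_extensionProduct_right _ (extensionProduct_lengthProp c' d) _ hY)

/-- If all objects of the heart of `t₀` have cohomology with respect to `t` only in degrees `-1`
and `0`, then the Euler characteristic with respect to `t` is defined on the Grothendieck group of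
the heart of `t₀`. -/
lemma exists_eulerHom {t₀ : TStructure D} (h₁ : t₀.heart ≤ t.le 0)
    (h₂ : t₀.heart ≤ t.ge (-1)) :
    ∃ φ : GrothendieckGroup t₀.heart.FullSubcategory →+ ℤ,
      ∀ (X : t₀.heart.FullSubcategory) (k : ℤ), eulerProp t k X.obj →
        φ (grothendieckClass X) = k := by
  choose χ hχ using fun X : t₀.heart.FullSubcategory =>
    exists_eulerProp hfl (h₁ _ X.property) (h₂ _ X.property)
  have hker : AddSubgroup.closure (grothendieckRelations t₀.heart.FullSubcategory) ≤
      (FreeAbelianGroup.lift χ).ker := by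
    rw [AddSubgroup.closure_le]
    rintro _ ⟨S, hS, rfl⟩
    obtain ⟨δ, hT⟩ := exists_distTriang_of_shortExact hS
    have := eulerProp_unique hfl (hχ S.X₂) (eulerProp_add hfl hT (hχ S.X₁) (hχ S.X₃))
    simp [AddMonoidHom.mem_ker, this]
  refine ⟨QuotientAddGroup.lift _ (FreeAbelianGroup.lift χ) hker, fun X k hk => ?_⟩
  have : QuotientAddGroup.lift _ (FreeAbelianGroup.lift χ) hker (grothendieckClass X) = χ X :=
    (QuotientAddGroup.lift_mk _ _ _).trans (FreeAbelianGroup.lift_apply_of _ _)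
  rw [this]
  exact eulerProp_unique hfl (hχ X) hk

/-- A nonzero object which the t-structure `t` places in degree `1` and an object of the heart of
`t` have different classes: their Euler characteristics have different signs. -/
lemma grothendieckClass_ne {t₀ : TStructure D} (h₁ : t₀.heart ≤ t.le 0)
    (h₂ : t₀.heart ≤ t.ge (-1)) {S E : t₀.heart.FullSubcategory} (hS0 : ¬ IsZero S.obj)
    (hS : t.heart (S.obj⟦(-1 : ℤ)⟧)) (hE : t.heart E.obj) :
    grothendieckClass E ≠ grothendieckClass S := by
  intro heq
  obtain ⟨φ, hφ⟩ := exists_eulerHom hfl h₁ h₂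
  obtain ⟨m, hm⟩ := exists_lengthProp hfl hE
  obtain ⟨n, hn⟩ := exists_lengthProp hfl hS
  have hE' := hφ E _ (eulerProp_of_lengthProp hm)
  have hS' := hφ S _ (eulerProp_neg_of_lengthProp hn)
  rw [heq, hS'] at hE'
  obtain rfl : n = 0 := by lia
  apply hS0
  exact (((shiftFunctor D (1 : ℤ)).map_isZero hn).of_iso
    ((shiftEquiv D (1 : ℤ)).counitIso.symm.app S.obj))

end Euler

/-! ### Torsion pairs under a simple tilt -/

section Next

variable {D : Type u} [Category.{v} D] [Preadditive D] [HasZeroObject D] [HasShift D ℤ]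
  [∀ n : ℤ, (shiftFunctor D n).Additive] [Pretriangulated D]

variable {t : TStructure D} {T F : ObjectProperty D} {S : D}

namespace IsTorsionPairIn

lemma closureOf_le_left (h : IsTorsionPairIn t T F) (hTS : T S) : closureOf S ≤ T := by
  have := h.isClosedUnderIsomorphisms_left
  have := h.containsZero_left
  have := h.isTriangulatedClosed₂_left
  exact closureOf_le hTS

/-- A torsion class `T` containing the simple object `S` is `⟨S⟩ ⋆ {X ∈ T | Hom(S, X) = 0}`. -/
lemma left_eq_extensionProduct (h : IsTorsionPairIn t T F)
    (hS : IsTorsionPairIn t (closureOf S) (rightOrthogonalIn t S)) (hTS : T S) :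
    T = extensionProduct (closureOf S) (fun X => T X ∧ ∀ f : S ⟶ X, f = 0) := by
  have := h.isClosedUnderIsomorphisms_left
  have := h.isTriangulatedClosed₂_left
  apply le_antisymm
  · intro X hX
    obtain ⟨P, Q, f, g, k, hT, hP, hQ⟩ := hS.heart_le X (h.left_le X hX)
    exact ⟨P, Q, f, g, k, hT, hP, h.left_of_distTriang hT (hS.left_le _ hP) hX hQ.1, hQ.2⟩
  · exact extensionProduct_le_of_isTriangulatedClosed₂ (h.closureOf_le_left hTS) fun _ hX => hX.1

variable [IsTriangulated D]

/-- If `(T, F)` is a torsion pair in the heart and the simple object `S` lies in `T`, then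
`({X ∈ T | Hom(S, X) = 0}, F ⋆ ⟨S⟩[-1])` is a torsion pair in the simple tilt at `S`. -/
lemma tilt_isTorsionPairIn (h : IsTorsionPairIn t T F)
    (hS : IsTorsionPairIn t (closureOf S) (rightOrthogonalIn t S)) (hTS : T S) :
    IsTorsionPairIn hS.tilt (fun X => T X ∧ ∀ f : S ⟶ X, f = 0)
      (extensionProduct F ((closureOf S).shift (1 : ℤ))) where
  isClosedUnderIsomorphisms_left := by
    have := h.isClosedUnderIsomorphisms_left
    exact ⟨fun {X Y} e hX => ⟨T.prop_of_iso e hX.1, fun f => by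
      rw [← cancel_mono e.inv, hX.2 (f ≫ e.inv), zero_comp]⟩⟩
  isClosedUnderIsomorphisms_right := inferInstance
  left_le := by
    rw [hS.heart_tilt]
    have : ((closureOf S).shift (1 : ℤ)).ContainsZero :=
      ⟨_, isZero_zero D, .zero _ ((shiftFunctor D (1 : ℤ)).map_isZero (isZero_zero D))⟩
    exact fun X hX => le_extensionProduct_left _ _ ⟨h.left_le _ hX.1, hX.2⟩
  right_le := by
    rw [hS.heart_tilt]
    exact monotone_extensionProduct_left _ fun X hX =>
      ⟨h.right_le _ hX, h.hom_eq_zero hTS hX⟩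
  hom_eq_zero := by
    rintro X E hX ⟨Y, Z, f, g, k, hT, hY, hZ⟩ a
    obtain ⟨b, rfl⟩ := exists_lift_of_comp_eq_zero hT a
      (hom_eq_zero_of_le_of_ge (h.left_le _ hX.1).1 (hS.left_shift_le_ge _ hZ) (by lia) _)
    rw [h.hom_eq_zero hX.1 hY b, zero_comp]
  heart_le := by
    rw [hS.heart_tilt, ← extensionProduct_assoc]
    apply monotone_extensionProduct_left
    intro X hX
    obtain ⟨P, Q, f, g, k, hT, hP, hQ⟩ := h.heart_le X hX.1
    exact ⟨P, Q, f, g, k, hT, ⟨hP, fun a => eq_zero_of_comp_mor₁_eq_zero hT (h.right_le _ hQ)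
      (h.left_le _ hTS) a (hX.2 _)⟩, hQ⟩

end IsTorsionPairIn

end Next

/-! ### Iterated products and indecomposable objects -/

section Products

variable {D : Type u} [Category.{v} D] [Preadditive D] [HasZeroObject D] [HasShift D ℤ]
  [∀ n : ℤ, (shiftFunctor D n).Additive] [Pretriangulated D]

/-- The product `⟨S₁⟩ ⋆ (⟨S₂⟩ ⋆ (⋯ ⋆ ⟨Sₘ⟩))`, formed in the triangulated category. -/
def closureProduct : List D → ObjectProperty D
  | [] => fun X => IsZero X
  | S :: L => extensionProduct (closureOf S) (closureProduct L)

instance (L : List D) : (closureProduct L).IsClosedUnderIsomorphisms := by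
  cases L with
  | nil => exact isClosedUnderIsomorphisms_isZero
  | cons S L => exact inferInstanceAs (extensionProduct _ _).IsClosedUnderIsomorphisms

variable {t : TStructure D}

/-- A simple object of another heart which lies in the heart of `t` has a skew field as its
endomorphism ring there. -/
lemma isEndoTrivial_of_simple {t' : TStructure D} (E : t.heart.FullSubcategory)
    (hE : simpleObjects t' E.obj) : IsEndoTrivial E := by
  refine ⟨fun h => not_isZero_of_simple hE ?_, fun f hf => ?_⟩
  · rw [IsZero.iff_id_eq_zero]
    exact congrArg (fun k => k.hom) h
  · have : IsIso (t.heart.ι.map f) := isIso_of_simple_of_ne_zero hE hE f.hom fun h => hf (by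
      ext
      exact h)
    exact isIso_of_fully_faithful t.heart.ι f

variable [IsTriangulated D]

/-- Left-bracketed and right-bracketed products agree, by associativity of the extension product. -/
lemma foldl_gabrielProduct (L : List t.heart.FullSubcategory) (P : ObjectProperty D)
    [P.IsClosedUnderIsomorphisms] (hP : P ≤ t.heart) :
    L.foldl (fun P E' => gabrielProduct P (generatedBy E')) (P.inverseImage t.heart.ι) =
      (extensionProduct P (closureProduct (L.map fun E => E.obj))).inverseImage t.heart.ι := by
  induction L generalizing P with
  | nil =>
    change _ = (extensionProduct P (fun X : D => IsZero X)).inverseImage t.heart.ι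
    rw [extensionProduct_isZero]
    rfl
  | cons E L ih =>
    have hE : closureOf E.obj ≤ t.heart := closureOf_le E.property
    rw [List.foldl_cons, generatedBy_eq_inverseImage, gabrielProduct_inverseImage hP hE,
      ih _ (extensionProduct_le_of_isTriangulatedClosed₂ hP hE), extensionProduct_assoc]
    rfl

lemma iteratedProduct_eq_inverseImage (L : List t.heart.FullSubcategory) :
    iteratedProduct L = (closureProduct (L.map fun E => E.obj)).inverseImage t.heart.ι := by
  cases L with
  | nil =>
    ext X
    refine ⟨fun hX => t.heart.ι.map_isZero hX, fun hX => ?_⟩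
    refine (IsZero.iff_id_eq_zero X).2 ?_
    ext
    exact IsZero.eq_of_src hX _ _
  | cons E L =>
    rw [iteratedProduct, generatedBy_eq_inverseImage,
      foldl_gabrielProduct L _ (closureOf_le E.property)]
    rfl

end Products

/-- An object whose endomorphism ring is a skew field is indecomposable: the projection to a direct
summand is zero or invertible. -/
lemma IsEndoTrivial.isIndecomposable {C : Type u} [Category.{v} C] [HasZeroMorphisms C] {E : C}
    (hE : IsEndoTrivial E) : IsIndecomposable E := by
  refine ⟨fun h => hE.1 (h.eq_of_src _ _), ?_⟩
  rintro X Y b - ⟨e⟩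
  by_cases hf : e.hom ≫ (b.fst ≫ b.inl) ≫ e.inv = 0
  · left
    have h₀ : b.fst ≫ b.inl = 0 := by
      simpa using congrArg (fun k => e.inv ≫ k ≫ e.hom) hf
    have h₁ : b.inl = 0 := by
      simpa using congrArg (fun k => b.inl ≫ k) h₀
    rw [IsZero.iff_id_eq_zero, ← b.inl_fst, h₁, zero_comp]
  · right
    have := hE.2 _ hf
    have h₁ : b.inr = 0 := by
      have : (b.inr ≫ e.inv) ≫ (e.hom ≫ (b.fst ≫ b.inl) ≫ e.inv) = 0 := by simp
      rw [← cancel_mono (e.inv ≫ (e.hom ≫ (b.fst ≫ b.inl) ≫ e.inv))]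
      simp
    rw [IsZero.iff_id_eq_zero, ← b.inr_snd, h₁, zero_comp]

/-- The classes in the Grothendieck group of the objects whose endomorphism ring is a skew
field. -/
def endoTrivialClasses (C : Type u) [Category.{v} C] [HasZeroMorphisms C] :
    Set (GrothendieckGroup C) :=
  {c | ∃ E : C, IsEndoTrivial E ∧ grothendieckClass E = c}

/-! ### The green sequence of a torsion class -/

section Green

variable {D : Type u} [Category.{v} D] [Preadditive D] [HasZeroObject D] [HasShift D ℤ]
  [∀ n : ℤ, (shiftFunctor D n).Additive] [Pretriangulated D]

/-- The bound `t'.le 0 ≤ t.le 1`, passed to right orthogonals. -/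
lemma ge_zero_le_of_le_zero_le {t t' : TStructure D} (h : t'.le 0 ≤ t.le 1) :
    t.ge 0 ≤ t'.ge (-1) := by
  intro X hX
  rw [t'.ge_iff_isGE, t'.isGE_iff_orthogonal (-2) (-1) (by lia)]
  intro Y f hY
  have hY' : t.le (-1) Y := by
    have := hY.le
    rw [← t'.shift_le (-2) 0 (-2) (by lia)] at this
    rw [← t.shift_le (-2) 1 (-1) (by lia)]
    exact h _ this
  exact hom_eq_zero_of_le_of_ge hY' hX (by lia) f

variable [IsTriangulated D]

/-- The recursion that produces the green sequence. The t-structure `t'` is reached after some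
tilts, `T` is what remains of the torsion class, and `U` consists of the classes of the simple
objects used so far. These classes do not occur in `t.heart ⊓ t'.heart` any more. -/
theorem exists_greenFrom (t : TStructure D) (htilt : CanBeTiltedIndefinitely t.heart)
    (hfinite : (endoTrivialClasses t.heart.FullSubcategory).Finite)
    (n : ℕ) (U : Set (GrothendieckGroup t.heart.FullSubcategory))
    (hn : (endoTrivialClasses t.heart.FullSubcategory \ U).ncard = n)
    (t' : TStructure D) (ht' : IsIteratedSimpleTilt t.heart t'.heart)
    (hle : t.le 0 ≤ t'.le 0) (hle' : t'.le 0 ≤ t.le 1)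
    (hU : ∀ E : t.heart.FullSubcategory, t'.heart E.obj → grothendieckClass E ∉ U)
    (T F : ObjectProperty D) (hTF : IsTorsionPairIn t' T F) (hT : T ≤ t.heart) :
    ∃ L : List t.heart.FullSubcategory,
      (∀ E ∈ L, IsIndecomposable E) ∧
      IsGreenFrom t.heart t'.heart (L.map fun E => E.obj) ∧
      T = closureProduct (L.map fun E => E.obj) := by
  induction n using Nat.strong_induction_on generalizing U t' T F with
  | _ n ih =>
  have hTiso := hTF.isClosedUnderIsomorphisms_left
  have hTzero := hTF.containsZero_left
  by_cases h0 : ∀ X, T X → IsZero X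
  · exact ⟨[], by simp, trivial, le_antisymm h0 fun X hX => T.prop_of_isZero hX⟩
  · push Not at h0
    obtain ⟨X, hX, hX0⟩ := h0
    have hfl := (htilt _ ht').1.1
    obtain ⟨K, S, f, g, k, hKXS, hK, hS⟩ := exists_simple_quotient hfl (hTF.left_le X hX) hX0
    have hTS : T S := hTF.left_of_distTriang hKXS hK hX hS.1
    let E : t.heart.FullSubcategory := ⟨S, hT S hTS⟩
    have hE : IsEndoTrivial E := isEndoTrivial_of_simple E hS
    have hS' := isTorsionPairIn_simple hfl hS
    obtain ⟨hS₀, hSimple⟩ := id hS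
    have heq : simpleTilt t'.heart ⟨S, hS₀⟩ = hS'.tilt.heart := simpleTilt_eq_heart_tilt hS'
    have ht'' : IsIteratedSimpleTilt t.heart hS'.tilt.heart := by
      rw [← heq]
      exact .tilt _ _ ht' hSimple
    have hle₁ : t.le 0 ≤ hS'.tilt.le 0 := by
      rw [hS'.tilt_le_zero]
      exact hle.trans hS'.le_tiltLE
    have hle₂ : hS'.tilt.le 0 ≤ t.le 1 := by
      rw [hS'.tilt_le_zero]
      refine extensionProduct_le_of_isTriangulatedClosed₂ hle' ?_
      rw [← t.shift_le 1 0 1 (by lia)]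
      exact fun Y hY => (closureOf_le E.property _ hY).1
    have hSshift : hS'.tilt.heart (S⟦(-1 : ℤ)⟧) := by
      rw [hS'.heart_tilt]
      have := hS'.containsZero_right
      exact le_extensionProduct_right _ _ ((closureOf S).prop_of_iso
        ((shiftEquiv D (1 : ℤ)).counitIso.symm.app S) (closureOf_self S))
    have hU' : ∀ E' : t.heart.FullSubcategory, hS'.tilt.heart E'.obj →
        grothendieckClass E' ∉ insert (grothendieckClass E) U := by
      intro E' hE'
      rw [Set.mem_insert_iff, not_or]
      refine ⟨grothendieckClass_ne (htilt _ ht'').1.1 (fun Y hY => hle₁ _ hY.1)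
        (fun Y hY => ge_zero_le_of_le_zero_le hle₂ _ hY.2)
        (not_isZero_of_simple hS) hSshift hE', hU E' ⟨hle _ E'.property.1, ?_⟩⟩
      -- An object of the tilted heart is `≥ 0`, and an object of `t.heart` is `≤ 0`, for `t'`.
      have := hE'.2
      rw [hS'.tilt_ge_zero] at this
      exact extensionProduct_le_of_isTriangulatedClosed₂ (fun Y hY => hY.1.2)
        (t'.ge_antitone (by lia)) _ this
    have hlt : (endoTrivialClasses t.heart.FullSubcategory \
        insert (grothendieckClass E) U).ncard < n := by
      rw [← hn]
      refine Set.ncard_lt_ncard ⟨Set.sdiff_subset_sdiff_right (Set.subset_insert _ _),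
        fun hsub => ?_⟩ hfinite.sdiff
      exact (hsub ⟨⟨E, hE, rfl⟩, hU E hS₀⟩).2 (Set.mem_insert _ _)
    obtain ⟨L, hL, hgreen, hprod⟩ := ih _ hlt _ rfl hS'.tilt ht'' hle₁ hle₂ hU' _ _
      (hTF.tilt_isTorsionPairIn hS' hTS) (fun Y hY => hT _ hY.1)
    refine ⟨E :: L, ?_, ⟨E.property, hS₀, hSimple, ?_⟩, ?_⟩
    · rintro E' hE'
      obtain rfl | hE' := List.mem_cons.1 hE'
      · exact hE.isIndecomposable
      · exact hL _ hE'
    · rw [heq]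
      exact hgreen
    · change T = extensionProduct (closureOf S) (closureProduct (L.map fun E => E.obj))
      rw [← hprod]
      exact hTF.left_eq_extensionProduct hS' hTS

/-- A torsion pair in the heart, viewed in the triangulated category. -/
lemma IsTorsionPair.isTorsionPairIn {t : TStructure D}
    {T F : ObjectProperty t.heart.FullSubcategory} (h : IsTorsionPair T F) :
    IsTorsionPairIn t (T.map t.heart.ι) (F.map t.heart.ι) where
  isClosedUnderIsomorphisms_left := inferInstance
  isClosedUnderIsomorphisms_right := inferInstance
  left_le := by
    rintro X ⟨Y, -, ⟨e⟩⟩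
    exact t.heart.prop_of_iso e Y.property
  right_le := by
    rintro X ⟨Y, -, ⟨e⟩⟩
    exact t.heart.prop_of_iso e Y.property
  hom_eq_zero := by
    rintro X X' ⟨Y, hY, ⟨e⟩⟩ ⟨Y', hY', ⟨e'⟩⟩ f
    have h0 : e.hom ≫ f ≫ e'.inv = 0 :=
      congrArg (fun k => k.hom) (h.hom_eq_zero hY hY' (t.heart.homMk (e.hom ≫ f ≫ e'.inv)))
    rwa [← cancel_epi e.hom, ← cancel_mono e'.inv, Category.assoc, comp_zero, zero_comp]
  heart_le X hX := by
    obtain ⟨Y, Z, i, p, w, hS, hY, hZ⟩ := h.gabrielProduct ⟨X, hX⟩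
    obtain ⟨δ, hT⟩ := exists_distTriang_of_shortExact hS
    exact ⟨_, _, _, _, δ, hT, prop_map_obj _ _ hY, prop_map_obj _ _ hZ⟩

end Green

end HeartTilting

theorem mainTheorem5 {D : Type u} [Category.{v} D] [Preadditive D] [HasZeroObject D]
    [HasShift D ℤ] [∀ n : ℤ, (shiftFunctor D n).Additive] [Pretriangulated D] [IsTriangulated D]
    (t : TStructure D) (hbounded : ∀ X : D, t.bounded X)
    (halgebraic : IsAlgebraic t.heart.FullSubcategory)
    (htilt : CanBeTiltedIndefinitely t.heart)
    (hfinite : {c : GrothendieckGroup t.heart.FullSubcategory |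
      ∃ E : t.heart.FullSubcategory, IsEndoTrivial E ∧ grothendieckClass E = c}.Finite)
    (T : ObjectProperty t.heart.FullSubcategory) (hT : IsTorsionClass T) :
    ∃ L : List t.heart.FullSubcategory,
      (∀ E ∈ L, IsIndecomposable E) ∧
      IsGreenSequence t.heart (L.map fun E => E.obj) ∧
      T = iteratedProduct L := by
  obtain ⟨F, hF⟩ := hT
  obtain ⟨L, hL, hgreen, hprod⟩ := exists_greenFrom t htilt hfinite _ ∅ rfl t .refl le_rfl
    (t.le_monotone (by lia)) (fun _ _ => Set.notMem_empty _) _ _ hF.isTorsionPairIn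
    hF.isTorsionPairIn.left_le
  refine ⟨L, hL, hgreen, ?_⟩
  rw [iteratedProduct_eq_inverseImage, ← hprod]
  have := hF.isClosedUnderIsomorphisms_left
  ext X
  refine ⟨fun hX => T.prop_map_obj _ hX, ?_⟩
  rintro ⟨Y, hY, ⟨e⟩⟩
  exact T.prop_of_iso (t.heart.ι.preimageIso e) hY
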